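/- **Model.** For $\theta=(\mu_0,\mu_1,\Sigma,\alpha)$ with $\mu_0,\mu_1\in\mathbb R^d$, $\Sigma\in\mathbb R^{d\times d}$ positive definite and $\alpha\in[0,1]$, let $P_\theta$ be the law of $(Y,X)\in\{0,1\}\times\mathbb R^d$ where $Z$ is uniform on $\{0,1\}$, $X\mid Z=z\sim N(\mu_z,\Sigma)$ and, independently of $X$ given $Z$, $P(Y=Z)=(1+\alpha)/2$ and $P(Y=1-Z)=(1-\alpha)/2$. Put $\rho(\theta)=(\mu_0-\mu_1)^\top\Sigma^{-1}(\mu_0-\mu_1)$. For known $\Sigma,\alpha$, test $\theta\in\mathcal G_0(\Sigma)=\{\theta:\mu_0=\mu_1\}$ against $\theta\in\mathcal G_1(\Sigma;\gamma_n)=\{\theta:\|\mu_0-\mu_1\|_0\le s,\ \rho(\theta)\ge\gamma_n\}$. Here $d=d_n$, $s=s_n\ge 1$, $\alpha=\alpha_n\in[0,1]$, $\gamma_n\ge 0$ and $\xi=\xi_n\in[0,1)$ may depend on the sample size $n$, which drives all asymptotics. **Statistical query model.** An algorithm $\mathscr A$ (possibly adaptive and randomized) asks at most $T$ queries $q$ from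 its query space $\mathcal Q_{\mathscr A}$, a set of measurable functions $\{0,1\}\times\mathbb R^d\to[-M,M]$, $M>0$; each query may depend measurably on a random seed and on the earlier answers. $\mathcal A(T)$ is the set of these algorithms. Let $\eta(\mathcal Q_{\mathscr A})$ be a capacity of the query space in logarithmic scale: a real number with $\eta(\mathcal Q_{\mathscr A})\ge\log|F|$ for each finite set $F\subseteq\mathcal Q_{\mathscr A}$ having at most as many elements as $\mathscr A$ has rounds, such as $\log|\mathcal Q_{\mathscr A}|$ for finite $\mathcal Q_{\mathscr A}$. An oracle has, under each $\theta$, random variables $Z_q$, and answers the query $q$ by $Z_q$. It is admissible, $r\in\mathcal R[\xi,n,T,\eta(\mathcal Q_{\mathscr A})]$, if under every $\theta$ of the model, with probability at least $1-2\xi$, $|Z_q-\mathbb E_\theta q(Y,X)|\le\tau_q$ for all $q\in\mathcal Q_{\mathscr A}$ simultaneously, where, with $L=\eta(\mathcal Q_{\mathscr A})+\log(1/\xi)$, $$\tau_q=\frac{L M}{n}\ \vee\ \sqrt{\frac{2L\,\bigl(M^2-\{\mathbb E_\theta q(Y,X)\}^2\bigr)}{n}}$$ ($\tau_q=\infty$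 if $\xi=0$). The oracle minimax risk $\overline R_n^*(\mathcal G_0,\mathcal G_1;\mathscr A,r)$ is the infimum of $\sup_{\theta\in\mathcal G_0}\overline P_\theta(\phi=1)+\sup_{\theta\in\mathcal G_1}\overline P_\theta(\phi=0)$ over all $\{0,1\}$-valued measurable functions $\phi$ of the seed, the queries and the answers. **Theorem.** Assume that $s=o(d^{1/2-\delta})$ for some constant $\delta>0$ and that $$\gamma_n=o\Bigl\{\gamma_n^*\ \vee\ \Bigl[\sqrt{s^2/n}\wedge\Bigl(\tfrac1{\alpha^2}\cdot\tfrac sn\Bigr)\Bigr]\Bigr\},\qquad \gamma_n^*=\sqrt{\tfrac{s\log d}{n}}\wedge\Bigl(\tfrac1{\alpha^2}\cdot\tfrac{s\log d}{n}\Bigr),$$ with $1/\alpha^2=\infty$ when $\alpha=0$. Then every computationally tractable test is asymptotically powerless under the statistical query model: for every constant $\eta>0$ and all algorithms $\mathscr A=\mathscr A_{n,\Sigma}\in\mathcal A(d^\eta)$ (which may depend on the known $\Sigma$) there are oracles $r=r_{n,\Sigma}\in\mathcal R[\xi,n,d^\eta,\eta(\mathcal Q_{\mathscr A})]$ such that $$\lim_{n\to\infty}\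 \sup_{\Sigma\succ 0}\ \overline R_n^*\bigl[\mathcal G_0(\Sigma),\mathcal G_1(\Sigma;\gamma_n);\mathscr A,r\bigr]=1 .$$ -/

import Mathlib

open MeasureTheory ProbabilityTheory Filter Topology
open scoped ENNReal

noncomputable section

/-! ### The statistical model -/

/-- The covariate space `ℝ^d`. -/
abbrev Covariate (d : ℕ) : Type := EuclideanSpace ℝ (Fin d)

/-- A sample `(Y, X) ∈ {0, 1} × ℝ^d`. -/
abbrev Sample (d : ℕ) : Type := Fin 2 × Covariate d

/-- The model parameter `θ = (μ₀, μ₁, Σ, α)`. -/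
structure Param (d : ℕ) where
  /-- the two means `μ₀ = mean 0`, `μ₁ = mean 1` -/
  mean : Fin 2 → Covariate d
  /-- the covariance matrix `Σ` -/
  cov : Matrix (Fin d) (Fin d) ℝ
  /-- the degree of supervision `α` -/
  sup : ℝ

/-- The law `P_θ` of `(Y, X)`: the true label `Z` is uniform on `{0, 1}`, `X ∣ Z = z ∼ N(μ_z, Σ)`
and, independently of `X` given `Z`, `Y = Z` with probability `(1 + α) / 2` and `Y = 1 - Z` with
probability `(1 - α) / 2`. -/
def Param.law {d : ℕ} (θ : Param d) : Measure (Sample d) :=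
  ∑ z : Fin 2, ∑ y : Fin 2,
    ENNReal.ofReal (1 / 2 * (if y = z then (1 + θ.sup) / 2 else (1 - θ.sup) / 2)) •
      (Measure.dirac y).prod (multivariateGaussian (θ.mean z) θ.cov)

/-- `Δμ = μ₀ - μ₁`. -/
def Param.diff {d : ℕ} (θ : Param d) : Fin d → ℝ :=
  fun j => θ.mean 0 j - θ.mean 1 j

/-- The signal-to-noise ratio `(μ₀ - μ₁)ᵀ Σ⁻¹ (μ₀ - μ₁)`. -/
def Param.snr {d : ℕ} (θ : Param d) : ℝ :=
  dotProduct θ.diff (Matrix.mulVec θ.cov⁻¹ θ.diff)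

/-- All parameters with the known covariance matrix `S` and the known supervision level `α`. -/
def modelSpace {d : ℕ} (S : Matrix (Fin d) (Fin d) ℝ) (α : ℝ) : Set (Param d) :=
  {θ | θ.cov = S ∧ θ.sup = α}

/-- The null parameter space `G₀(Σ)`. -/
def nullSpace {d : ℕ} (S : Matrix (Fin d) (Fin d) ℝ) (α : ℝ) : Set (Param d) :=
  {θ ∈ modelSpace S α | θ.mean 0 = θ.mean 1}

/-- The alternative parameter space `G₁(Σ; γ)`: `s`-sparse mean difference and SNR at
least `γ`. -/
def altSpace {d : ℕ} (S : Matrix (Fin d) (Fin d) ℝ) (α : ℝ) (s : ℕ) (γ : ℝ) : Set (Param d) :=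
  {θ ∈ modelSpace S α | (Finset.univ.filter fun j => θ.diff j ≠ 0).card ≤ s ∧ γ ≤ θ.snr}

/-! ### The statistical query model -/

/-- A (measurable) query function `q : {0, 1} × ℝ^d → [-M, M]`. -/
def Query (d : ℕ) (M : ℝ) : Type :=
  {q : Sample d → ℝ // Measurable q ∧ ∀ p, |q p| ≤ M}

/-- `E_θ[q(Y, X)]`. -/
def Query.mean {d : ℕ} {M : ℝ} (q : Query d M) (θ : Param d) : ℝ :=
  ∫ p, q.1 p ∂θ.law

/-- A (possibly randomized, adaptive) statistical query algorithm. It draws a random seed, and its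
`t`-th query, an element of its query space `queries`, depends on the seed and on the previous
answers (the previous queries are determined by these). It asks `rounds` queries; stopping earlier
amounts to repeating a query, which is answered in the same way. A deterministic algorithm is one
that ignores the seed. -/
structure SQAlgorithm (d : ℕ) (M : ℝ) where
  /-- the query space -/
  queries : Set (Query d M)
  /-- the number of rounds -/
  rounds : ℕ
  /-- the space of random seeds -/
  Seed : Type
  /-- its measurable structure -/
  [seedSpace : MeasurableSpace Seed]
  /-- the law of the seed -/
  seedLaw : Measure Seed
  [seedProb : IsProbabilityMeasure seedLaw]
  /-- the next query, given the seed and the `t` answers so far -/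
  next : (t : ℕ) → Seed → (Fin t → ℝ) → Query d M
  next_mem : ∀ t u h, next t u h ∈ queries
  measurable_next : ∀ t,
    Measurable fun p : (Seed × (Fin t → ℝ)) × Sample d => (next t p.1.1 p.1.2).1 p.2

attribute [instance] SQAlgorithm.seedSpace SQAlgorithm.seedProb

/-- The first `t` answers received on the seed `u` if every query `q` is answered by `z q`. -/
def SQAlgorithm.answers {d : ℕ} {M : ℝ} (A : SQAlgorithm d M) (u : A.Seed) (z : Query d M → ℝ) :
    (t : ℕ) → Fin t → ℝ
  | 0 => Fin.elim0
  | t + 1 => Fin.snoc (α := fun _ => ℝ) (A.answers u z t) (z (A.next t u (A.answers u z t)))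

/-- `η` is a capacity (on the logarithmic scale) of the query space of `A`: it is at least the
logarithm of the number of elements of every set of queries that can be asked within the budget.
For a finite query space, `η = log |Q|` is such a number; the query space may also be infinite. -/
def SQAlgorithm.IsCapacity {d : ℕ} {M : ℝ} (A : SQAlgorithm d M) (η : ℝ) : Prop :=
  ∀ F : Finset (Query d M), (F : Set (Query d M)) ⊆ A.queries → F.card ≤ A.rounds →
    Real.log F.card ≤ η

/-- The tolerance `τ_q` for capacity `η`, tail probability `ξ > 0`, range `[-M, M]`, sample size
`n` and expectation `e = E[q(Y, X)]`. -/
def tolerance (η ξ M : ℝ) (n : ℕ) (e : ℝ) : ℝ :=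
  max ((η + Real.log (1 / ξ)) * M / n)
    (Real.sqrt (2 * (η + Real.log (1 / ξ)) * (M ^ 2 - e ^ 2) / n))

/-- A statistical oracle: for every parameter `θ`, a family of real variables `Z_q`, indexed by the
query functions `q`, on a probability space. -/
structure SQOracle (d : ℕ) (M : ℝ) where
  /-- the sample space of the oracle -/
  Ω : Type
  /-- its measurable structure -/
  [space : MeasurableSpace Ω]
  /-- the probability measure under the parameter `θ` -/
  prob : Param d → Measure Ω
  [isProb : ∀ θ, IsProbabilityMeasure (prob θ)]
  /-- the answer `Z_q` under the parameter `θ` -/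
  answer : Param d → Query d M → Ω → ℝ

attribute [instance] SQOracle.space SQOracle.isProb

/-- The oracle `r` is an admissible oracle for the algorithm `A`, when the model has covariance `S`
and supervision level `α`: the variables `Z_q` and the sequence of answers during the interaction
with `A` are random variables and, under each parameter of the model, with probability at least
`1 - 2 ξ` all `Z_q`, `q` in the query space of `A`, are within the tolerance `τ_q` of `E_θ[q]`.
For `ξ = 0` the tolerance is infinite and nothing is required of the answers. -/
structure SQOracle.Admissible {d : ℕ} {M : ℝ} (r : SQOracle d M) (A : SQAlgorithm d M)
    (η ξ : ℝ) (n : ℕ) (S : Matrix (Fin d) (Fin d) ℝ) (α : ℝ) : Prop where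
  measurable_answer : ∀ θ ∈ modelSpace S α, ∀ q ∈ A.queries, Measurable (r.answer θ q)
  measurable_answers : ∀ θ ∈ modelSpace S α, ∀ t,
    Measurable fun p : A.Seed × r.Ω => A.answers p.1 (fun q => r.answer θ q p.2) t
  within_tolerance : 0 < ξ → ∀ θ ∈ modelSpace S α,
    r.prob θ {ω | ∃ q ∈ A.queries,
      tolerance η ξ M n (q.mean θ) < |r.answer θ q ω - q.mean θ|} ≤ ENNReal.ofReal (2 * ξ)

/-- The probability, under the parameter `θ`, that the seed of `A` and the answers of the oracle `r`
to the queries of `A` fall into `R`; the seed and the oracle are independent. -/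
def SQOracle.transcriptProb {d : ℕ} {M : ℝ} (r : SQOracle d M) (A : SQAlgorithm d M)
    (θ : Param d) (R : Set (A.Seed × (Fin A.rounds → ℝ))) : ℝ≥0∞ :=
  (A.seedLaw.prod (r.prob θ))
    {p | (p.1, A.answers p.1 (fun q => r.answer θ q p.2) A.rounds) ∈ R}

/-- The oracle minimax risk of testing `G₀` against `G₁` with `A` and `r`. A test `φ` is a
measurable function of the queries and the answers (all of them determined by the seed and the
answers), given here by its rejection region `R = {φ = 1}`. -/
def oracleRisk {d : ℕ} {M : ℝ} (G₀ G₁ : Set (Param d)) (A : SQAlgorithm d M)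
    (r : SQOracle d M) : ℝ≥0∞ :=
  ⨅ (R : Set (A.Seed × (Fin A.rounds → ℝ))) (_ : MeasurableSet R),
    ((⨆ θ ∈ G₀, r.transcriptProb A θ R) + ⨆ θ ∈ G₁, r.transcriptProb A θ Rᶜ)

/-! ### The rates -/

/-- `a ∧ (1 / α² · b)`, where `1 / α² = ∞` for `α = 0`. -/
def minSupervised (α a b : ℝ) : ℝ :=
  if α = 0 then a else min a (1 / α ^ 2 * b)

/-- The information-theoretic rate `γ_n^* = √(s log d / n) ∧ (1/α² · s log d / n)`. -/
def infoRate (n d s : ℕ) (α : ℝ) : ℝ :=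
  minSupervised α (Real.sqrt (s * Real.log d / n)) (s * Real.log d / n)

/-- The rate `√(s² / n) ∧ (1/α² · s / n)`. -/
def queryRate (n s : ℕ) (α : ℝ) : ℝ :=
  minSupervised α (Real.sqrt ((s : ℝ) ^ 2 / n)) (s / n)

end

/-! The oracle `nullOracle` hides the alternative: it replies with the null expectation of a query
whenever the tolerance permits. A test therefore learns something only from queries whose
expectation moves by more than the tolerance. As the risk never exceeds 1 and the supremum runs over
all covariances, it is enough to bound the risk from below at unit covariance. This is done with a
large family of alternatives of which each query detects a tiny fraction: the null run asks few
queries, so most alternatives produce exactly the null transcript (`one_sub_le_oracleRisk`).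

The family has means `v` and `-v`, where `v` has one entry `√(γ/(4s))` in each of `s` disjoint
blocks of `D` coordinates. Put `b = γ/(4s)`. Two alternatives agreeing in `k` blocks have likelihood
ratios with covariance `cosh(bk) - 1 + α² sinh(bk)`, which vanishes for `k = 0` and is at most `(b²
+ α²b) exp((b+2)k)` otherwise. By Cauchy–Schwarz (`sq_sum_abs_integral_sub_le`), the deviations of
one query over a set `C` of alternatives are controlled by the covariances over `C × C`. If all of
`C` is detected, then `L/n` is at most a constant times the average covariance on `C`. Since `s²
d^{2δ} ≤ d` up to constants, large overlaps are rare, so this average is small unless `C` is very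
small (`lt_of_le_card_detected`). The rate assumption makes `b² + α²b` of smaller order than `log d
/ n`.

Two regimes finish the proof (`le_oracleRisk_of_rate`). If the capacity is at least `(δ/4) log d`,
the tolerance itself carries the factor `log d`; each query detects at most a fraction `d^{-(η+1)}`,
and the budget `d^η` is harmless. If the capacity is smaller, at most `d^{δ/4}` distinct queries are
asked, and each detects at most a fraction `d^{-δ/2}`, already because disjoint supports are
uncorrelated. -/

noncomputable section

/-! ### Change of measure for Gaussian shifts -/

/-- The likelihood ratio of `N(a, 1)` with respect to `N(0, 1)` in dimension `d`. -/
def gaussianShiftDensity {d : ℕ} (a x : Covariate d) : ℝ :=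
  Real.exp (inner ℝ a x - ‖a‖ ^ 2 / 2)

lemma gaussianReal_one_eq_withDensity (a : ℝ) :
    gaussianReal a 1 =
      (gaussianReal 0 1).withDensity fun x => ENNReal.ofReal (Real.exp (a * x - a ^ 2 / 2)) := by
  rw [gaussianReal_of_var_ne_zero _ one_ne_zero, gaussianReal_of_var_ne_zero _ one_ne_zero,
    ← withDensity_mul _ (measurable_gaussianPDF 0 1) (by fun_prop)]
  congr 1
  ext x
  rw [Pi.mul_apply, gaussianPDF, gaussianPDF, ← ENNReal.ofReal_mul (gaussianPDFReal_nonneg _ _ _),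
    gaussianPDFReal, gaussianPDFReal, mul_assoc _ (Real.exp _), ← Real.exp_add]
  congr 3
  simp
  ring

lemma integrable_exp_gaussianReal (a : ℝ) :
    Integrable (fun x => Real.exp (a * x - a ^ 2 / 2)) (gaussianReal 0 1) := by
  simp_rw [Real.exp_sub]
  exact (integrable_exp_mul_gaussianReal a).div_const _

lemma pi_gaussianReal_one_eq_withDensity {ι : Type*} [Fintype ι] (a : ι → ℝ) :
    Measure.pi (fun i => gaussianReal (a i) 1) =
      (Measure.pi fun _ : ι => gaussianReal 0 1).withDensity
        fun x => ENNReal.ofReal (∏ i, Real.exp (a i * x i - a i ^ 2 / 2)) := by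
  refine Measure.pi_eq fun s hs => ?_
  rw [withDensity_apply _ (MeasurableSet.univ_pi hs), Measure.restrict_pi_pi,
    ← ofReal_integral_eq_lintegral_ofReal
      (Integrable.fintype_prod fun i => (integrable_exp_gaussianReal (a i)).restrict)
      (ae_of_all _ fun x => Finset.prod_nonneg fun i _ => (Real.exp_pos _).le),
    integral_fintype_prod_eq_prod (f := fun i x => Real.exp (a i * x - a i ^ 2 / 2)),
    ENNReal.ofReal_prod_of_nonneg fun i _ => integral_nonneg fun x => (Real.exp_pos _).le]
  refine Finset.prod_congr rfl fun i _ => ?_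
  rw [gaussianReal_one_eq_withDensity (a i), withDensity_apply _ (hs i),
    ofReal_integral_eq_lintegral_ofReal (integrable_exp_gaussianReal (a i)).restrict
      (ae_of_all _ fun x => (Real.exp_pos _).le)]

lemma measurable_gaussianShiftDensity {d : ℕ} (a : Covariate d) :
    Measurable (gaussianShiftDensity a) := by
  unfold gaussianShiftDensity
  fun_prop

lemma multivariateGaussian_one_eq_withDensity {d : ℕ} (a : Covariate d) :
    multivariateGaussian a 1 = (multivariateGaussian (0 : Covariate d) 1).withDensity
      fun x => ENNReal.ofReal (gaussianShiftDensity a x) := by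
  have h1 : multivariateGaussian a 1 =
      (Measure.pi fun i => gaussianReal (a i) 1).map (WithLp.toLp 2) := by
    have : (fun i => gaussianReal (a i) 1) =
        fun i => (gaussianReal 0 1).map (fun x => a i + x) := by
      ext1 i
      rw [gaussianReal_map_const_add, zero_add]
    rw [this, ← Measure.pi_map_pi (fun i => by fun_prop), Measure.map_map (by fun_prop)
      (by fun_prop), multivariateGaussian, ← map_pi_eq_stdGaussian, Measure.map_map (by fun_prop)
      (by fun_prop)]
    congr 1
    ext x i
    simp
  have hm : Measurable fun x : Covariate d => ENNReal.ofReal (gaussianShiftDensity a x) :=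
    (measurable_gaussianShiftDensity a).ennreal_ofReal
  rw [h1, pi_gaussianReal_one_eq_withDensity, multivariateGaussian_zero_one,
    ← map_pi_eq_stdGaussian]
  ext s hs
  rw [Measure.map_apply (by fun_prop) hs, withDensity_apply _ hs,
    withDensity_apply _ (hs.preimage (by fun_prop)), setLIntegral_map hs hm (by fun_prop)]
  refine lintegral_congr fun x => ?_
  congr 1
  rw [gaussianShiftDensity, ← Real.exp_sum, Finset.sum_sub_distrib, ← Finset.sum_div,
    EuclideanSpace.real_norm_sq_eq]
  congr 2
  simp [PiLp.inner_apply, mul_comm]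

lemma integral_multivariateGaussian_one {d : ℕ} (a : Covariate d) (q : Covariate d → ℝ) :
    ∫ x, q x ∂multivariateGaussian a 1 =
      ∫ x, q x * gaussianShiftDensity a x ∂multivariateGaussian (0 : Covariate d) 1 := by
  rw [multivariateGaussian_one_eq_withDensity,
    integral_withDensity_eq_integral_toReal_smul
      (measurable_gaussianShiftDensity a).ennreal_ofReal (ae_of_all _ fun _ => ENNReal.ofReal_lt_top)]
  refine integral_congr_ae (ae_of_all _ fun x => ?_)
  simp only [smul_eq_mul]
  rw [gaussianShiftDensity, ENNReal.toReal_ofReal (Real.exp_pos _).le, mul_comm]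

lemma integrable_gaussianShiftDensity {d : ℕ} (a : Covariate d) :
    Integrable (gaussianShiftDensity a) (multivariateGaussian (0 : Covariate d) 1) := by
  have h : Integrable (fun _ : Covariate d => (1 : ℝ)) (multivariateGaussian a 1) :=
    integrable_const 1
  rw [multivariateGaussian_one_eq_withDensity,
    integrable_withDensity_iff_integrable_smul'
      (measurable_gaussianShiftDensity a).ennreal_ofReal
      (ae_of_all _ fun _ => ENNReal.ofReal_lt_top)] at h
  refine h.congr (ae_of_all _ fun x => ?_)
  simp [ENNReal.toReal_ofReal (Real.exp_pos _).le, gaussianShiftDensity]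

lemma integral_gaussianShiftDensity {d : ℕ} (a : Covariate d) :
    ∫ x, gaussianShiftDensity a x ∂multivariateGaussian (0 : Covariate d) 1 = 1 := by
  have h := integral_multivariateGaussian_one a fun _ => 1
  simpa using h.symm

/-- Completing the square keeps products of shift densities within the family, so every correlation
below has a closed form. -/
lemma gaussianShiftDensity_mul {d : ℕ} (a b x : Covariate d) :
    gaussianShiftDensity a x * gaussianShiftDensity b x =
      Real.exp (inner ℝ a b) * gaussianShiftDensity (a + b) x := by
  rw [gaussianShiftDensity, gaussianShiftDensity, gaussianShiftDensity, ← Real.exp_add,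
    ← Real.exp_add, norm_add_sq_real, inner_add_left]
  congr 1
  ring

lemma integrable_gaussianShiftDensity_mul {d : ℕ} (a b : Covariate d) :
    Integrable (fun x => gaussianShiftDensity a x * gaussianShiftDensity b x)
      (multivariateGaussian (0 : Covariate d) 1) := by
  simp_rw [gaussianShiftDensity_mul]
  exact (integrable_gaussianShiftDensity _).const_mul _

lemma integral_gaussianShiftDensity_mul {d : ℕ} (a b : Covariate d) :
    ∫ x, gaussianShiftDensity a x * gaussianShiftDensity b x
      ∂multivariateGaussian (0 : Covariate d) 1 = Real.exp (inner ℝ a b) := by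
  simp_rw [gaussianShiftDensity_mul]
  rw [integral_const_mul, integral_gaussianShiftDensity, mul_one]

/-! ### A second moment bound for query expectations -/

/-- The quadratic `t ↦ ∫ (t f + g)²` is nonnegative, so its discriminant is not positive. -/
lemma sq_integral_mul_le {Ω : Type*} [MeasurableSpace Ω] {P : Measure Ω} {f g : Ω → ℝ}
    (hf : MemLp f 2 P) (hg : MemLp g 2 P) :
    (∫ x, f x * g x ∂P) ^ 2 ≤ (∫ x, f x ^ 2 ∂P) * ∫ x, g x ^ 2 ∂P := by
  have hff := hf.integrable_sq
  have hgg := hg.integrable_sq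
  have hfg : Integrable (fun x => f x * g x) P := hf.integrable_mul hg
  have key : ∀ t : ℝ, 0 ≤ (∫ x, f x ^ 2 ∂P) * (t * t) + (2 * ∫ x, f x * g x ∂P) * t +
      ∫ x, g x ^ 2 ∂P := by
    intro t
    have h0 : 0 ≤ ∫ x, (f x * t + g x) ^ 2 ∂P := integral_nonneg fun x => sq_nonneg _
    have h1 : ∀ x, (f x * t + g x) ^ 2 = f x ^ 2 * (t * t) + (f x * g x) * (2 * t) + g x ^ 2 :=
      fun x => by ring
    simp_rw [h1] at h0
    have h2 : Integrable (fun x => f x ^ 2 * (t * t) + (f x * g x) * (2 * t)) P :=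
      (hff.mul_const _).add (hfg.mul_const _)
    rw [integral_add h2 hgg, integral_add (hff.mul_const _) (hfg.mul_const _), integral_mul_const,
      integral_mul_const] at h0
    linarith
  have := discrim_le_zero key
  rw [discrim] at this
  nlinarith

/-- If the densities `w i` have pairwise correlations `h i j` under `P`, the expectations of a
query bounded by `M` under the densities deviate little from its expectation under `P`. -/
lemma sq_sum_abs_integral_sub_le {Ω ι : Type*} [MeasurableSpace Ω] {P : Measure Ω}
    [IsProbabilityMeasure P] {M : ℝ} {q : Ω → ℝ} (hq : Measurable q) (hqM : ∀ x, |q x| ≤ M)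
    {w : ι → Ω → ℝ} (hw : ∀ i, MemLp (w i) 2 P) (hw1 : ∀ i, ∫ x, w i x ∂P = 1)
    {h : ι → ι → ℝ} (hwh : ∀ i j, ∫ x, w i x * w j x ∂P = 1 + h i j) (C : Finset ι) :
    (∑ i ∈ C, |(∫ x, q x * w i x ∂P) - ∫ x, q x ∂P|) ^ 2 ≤
      (M ^ 2 - (∫ x, q x ∂P) ^ 2) * ∑ i ∈ C, ∑ j ∈ C, |h i j| := by
  set e := ∫ x, q x ∂P with he
  have hq2 : MemLp q 2 P :=
    MemLp.of_bound hq.aestronglyMeasurable M (ae_of_all _ fun x => by simpa using hqM x)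
  have hq1 : Integrable q P := hq2.integrable one_le_two
  have hw1' : ∀ i, Integrable (w i) P := fun i => (hw i).integrable one_le_two
  have hwc : ∀ i, MemLp (fun x => w i x - 1) 2 P := fun i => (hw i).sub (memLp_const 1)
  -- Weighting by the signs of the deviations turns the sum of absolute values into one inner
  -- product of `q - e` with a combination of centred densities, so Cauchy–Schwarz is applied once.
  set σ : ι → ℝ := fun i => SignType.sign ((∫ x, q x * w i x ∂P) - e) with hσ
  have hσ1 : ∀ i, |σ i| ≤ 1 := by
    intro i
    rcases lt_trichotomy ((∫ x, q x * w i x ∂P) - e) 0 with h0 | h0 | h0 <;> simp [hσ, h0]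
  have hqc : MemLp (fun x => q x - e) 2 P := hq2.sub (memLp_const e)
  have hg : MemLp (fun x => ∑ i ∈ C, σ i * (w i x - 1)) 2 P :=
    memLp_finsetSum C fun i _ => (hwc i).const_mul (σ i)
  have hcs := sq_integral_mul_le hqc hg
  have hint : ∀ i, Integrable (fun x => (q x - e) * (w i x - 1)) P :=
    fun i => hqc.integrable_mul (hwc i)
  have hval : ∀ i, ∫ x, (q x - e) * (w i x - 1) ∂P = (∫ x, q x * w i x ∂P) - e := by
    intro i
    have h1 : ∀ x, (q x - e) * (w i x - 1) = q x * w i x - q x - (e * w i x - e) :=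
      fun x => by ring
    have h2 : Integrable (fun x => q x * w i x) P := hq2.integrable_mul (hw i)
    have h3 : Integrable (fun x => q x * w i x - q x) P := h2.sub hq1
    have h4 : Integrable (fun x => e * w i x - e) P :=
      ((hw1' i).const_mul e).sub (integrable_const e)
    simp_rw [h1]
    rw [integral_sub h3 h4, integral_sub h2 hq1, integral_sub ((hw1' i).const_mul e) (integrable_const e),
      integral_const_mul, hw1 i]
    simp [← he]
  have hL : ∫ x, (q x - e) * ∑ i ∈ C, σ i * (w i x - 1) ∂P =
      ∑ i ∈ C, |(∫ x, q x * w i x ∂P) - e| := by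
    have h1 : ∀ x, (q x - e) * ∑ i ∈ C, σ i * (w i x - 1) =
        ∑ i ∈ C, σ i * ((q x - e) * (w i x - 1)) := by
      intro x
      rw [Finset.mul_sum]
      exact Finset.sum_congr rfl fun i _ => by ring
    simp_rw [h1]
    rw [integral_finsetSum _ fun i _ => (hint i).const_mul _]
    refine Finset.sum_congr rfl fun i _ => ?_
    rw [integral_const_mul, hval]
    exact sign_mul_self _
  -- The term `e ^ 2` must be kept: the tolerance shrinks in the same way when the expectation
  -- approaches `M` or `-M`.
  have hV : ∫ x, (q x - e) ^ 2 ∂P ≤ M ^ 2 - e ^ 2 := by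
    have h1 : ∀ x, (q x - e) ^ 2 = q x ^ 2 - (2 * e * q x - e ^ 2) := fun x => by ring
    have h2 : ∫ x, q x ^ 2 ∂P ≤ M ^ 2 := by
      calc ∫ x, q x ^ 2 ∂P ≤ ∫ _, M ^ 2 ∂P :=
            integral_mono hq2.integrable_sq (integrable_const _) fun x =>
              sq_le_sq' (abs_le.1 (hqM x)).1 (abs_le.1 (hqM x)).2
        _ = M ^ 2 := by simp
    have h3 : Integrable (fun x => 2 * e * q x - e ^ 2) P :=
      (hq1.const_mul _).sub (integrable_const _)
    simp_rw [h1]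
    rw [integral_sub hq2.integrable_sq h3,
      integral_sub (hq1.const_mul _) (integrable_const _), integral_const_mul, ← he]
    simp
    nlinarith
  have hG : ∫ x, (∑ i ∈ C, σ i * (w i x - 1)) ^ 2 ∂P ≤ ∑ i ∈ C, ∑ j ∈ C, |h i j| := by
    have h1 : ∀ x, (∑ i ∈ C, σ i * (w i x - 1)) ^ 2 =
        ∑ i ∈ C, ∑ j ∈ C, σ i * σ j * ((w i x - 1) * (w j x - 1)) := by
      intro x
      rw [sq, Finset.sum_mul_sum]
      exact Finset.sum_congr rfl fun i _ => Finset.sum_congr rfl fun j _ => by ring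
    have h2 : ∀ i j, Integrable (fun x => (w i x - 1) * (w j x - 1)) P :=
      fun i j => (hwc i).integrable_mul (hwc j)
    have h3 : ∀ i j, ∫ x, (w i x - 1) * (w j x - 1) ∂P = h i j := by
      intro i j
      have h4 : ∀ x, (w i x - 1) * (w j x - 1) = w i x * w j x - w i x - (w j x - 1) :=
        fun x => by ring
      have h5 : Integrable (fun x => w i x * w j x) P := (hw i).integrable_mul (hw j)
      have h6 : Integrable (fun x => w i x * w j x - w i x) P := h5.sub (hw1' i)
      have h7 : Integrable (fun x => w j x - 1) P := (hw1' j).sub (integrable_const _)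
      simp_rw [h4]
      rw [integral_sub h6 h7,
        integral_sub h5 (hw1' i), integral_sub (hw1' j) (integrable_const _), hwh, hw1, hw1]
      simp
    simp_rw [h1]
    rw [integral_finsetSum _ fun i _ => integrable_finsetSum _ fun j _ => (h2 i j).const_mul _]
    refine Finset.sum_le_sum fun i _ => ?_
    rw [integral_finsetSum _ fun j _ => (h2 i j).const_mul _]
    refine Finset.sum_le_sum fun j _ => ?_
    rw [integral_const_mul, h3]
    calc σ i * σ j * h i j ≤ |σ i * σ j * h i j| := le_abs_self _
      _ = |σ i| * |σ j| * |h i j| := by rw [abs_mul, abs_mul]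
      _ ≤ 1 * 1 * |h i j| := by gcongr <;> exact hσ1 _
      _ = |h i j| := by ring
  rw [hL] at hcs
  refine hcs.trans (mul_le_mul hV hG (integral_nonneg fun x => sq_nonneg _) ?_)
  exact (integral_nonneg fun x => sq_nonneg _).trans hV

/-! ### Symmetric mean shifts in the model -/

/-- The parameter with means `v` and `-v`. -/
def symmParam {d : ℕ} (S : Matrix (Fin d) (Fin d) ℝ) (α : ℝ) (v : Covariate d) : Param d :=
  ⟨fun z => if z = 0 then v else -v, S, α⟩

instance Param.isFiniteMeasure_law {d : ℕ} (θ : Param d) : IsFiniteMeasure θ.law := by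
  unfold Param.law
  have (z y : Fin 2) : IsFiniteMeasure
      (ENNReal.ofReal (1 / 2 * (if y = z then (1 + θ.sup) / 2 else (1 - θ.sup) / 2)) •
        (Measure.dirac y).prod (multivariateGaussian (θ.mean z) θ.cov)) :=
    Measure.smul_finite _ ENNReal.ofReal_ne_top
  infer_instance

lemma integrable_law {d : ℕ} (θ : Param d) {F : Sample d → ℝ} (hF : Measurable F)
    (h : ∀ y z, Integrable (fun x => F (y, x)) (multivariateGaussian (θ.mean z) θ.cov)) :
    Integrable F θ.law := by
  unfold Param.law
  refine integrable_finsetSum_measure.2 fun z _ => integrable_finsetSum_measure.2 fun y _ => ?_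
  refine Integrable.smul_measure ?_ ENNReal.ofReal_ne_top
  rw [Measure.dirac_prod, integrable_map_measure hF.aestronglyMeasurable (by fun_prop)]
  exact h y z

lemma integral_law {d : ℕ} (θ : Param d) (hα : θ.sup ∈ Set.Icc (0 : ℝ) 1) {F : Sample d → ℝ}
    (hF : Measurable F)
    (h : ∀ y z, Integrable (fun x => F (y, x)) (multivariateGaussian (θ.mean z) θ.cov)) :
    ∫ p, F p ∂θ.law = ∑ z : Fin 2, ∑ y : Fin 2,
      1 / 2 * (if y = z then (1 + θ.sup) / 2 else (1 - θ.sup) / 2) *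
        ∫ x, F (y, x) ∂multivariateGaussian (θ.mean z) θ.cov := by
  have hi : ∀ z y, Integrable F ((Measure.dirac y).prod
      (multivariateGaussian (θ.mean z) θ.cov)) := fun z y => by
    rw [Measure.dirac_prod, integrable_map_measure hF.aestronglyMeasurable (by fun_prop)]
    exact h y z
  unfold Param.law
  rw [integral_finsetSum_measure fun z _ => integrable_finsetSum_measure.2 fun y _ =>
    (hi z y).smul_measure ENNReal.ofReal_ne_top]
  refine Finset.sum_congr rfl fun z _ => ?_
  rw [integral_finsetSum_measure fun y _ => (hi z y).smul_measure ENNReal.ofReal_ne_top]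
  refine Finset.sum_congr rfl fun y _ => ?_
  have hc : 0 ≤ 1 / 2 * (if y = z then (1 + θ.sup) / 2 else (1 - θ.sup) / 2) := by
    have := hα.1
    have := hα.2
    split_ifs <;> linarith
  rw [integral_smul_measure, ENNReal.toReal_ofReal hc, smul_eq_mul, Measure.dirac_prod,
    integral_map (by fun_prop) hF.aestronglyMeasurable]

lemma isProbabilityMeasure_law {d : ℕ} (θ : Param d) (hα : θ.sup ∈ Set.Icc (0 : ℝ) 1) :
    IsProbabilityMeasure θ.law := by
  have h := integral_law θ hα (F := fun _ => 1) measurable_const fun _ _ => integrable_const _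
  simp only [integral_const, smul_eq_mul, mul_one, Fin.sum_univ_two, probReal_univ] at h
  refine ⟨?_⟩
  rw [← ENNReal.toReal_eq_one_iff, ← Measure.real, h]
  simp
  ring

lemma symmParam_zero_mean {d : ℕ} (S : Matrix (Fin d) (Fin d) ℝ) (α : ℝ) (z : Fin 2) :
    (symmParam S α 0).mean z = 0 := by
  simp [symmParam]

/-- With equal means the label is a fair coin independent of `X`, whatever the supervision level. -/
lemma integral_law_symmParam_zero {d : ℕ} {α : ℝ} (hα : α ∈ Set.Icc (0 : ℝ) 1)
    {F : Sample d → ℝ} (hF : Measurable F)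
    (h : ∀ y, Integrable (fun x => F (y, x)) (multivariateGaussian (0 : Covariate d) 1)) :
    ∫ p, F p ∂(symmParam 1 α 0).law =
      1 / 2 * ∫ x, F (0, x) ∂multivariateGaussian (0 : Covariate d) 1 +
      1 / 2 * ∫ x, F (1, x) ∂multivariateGaussian (0 : Covariate d) 1 := by
  rw [integral_law _ hα hF fun y z => by rw [symmParam_zero_mean]; exact h y]
  simp only [symmParam_zero_mean, Fin.sum_univ_two]
  simp [symmParam]
  ring

/-- The density of the law with means `v` and `-v` and unit covariance with respect to the law
with zero means. -/
def symmDensity {d : ℕ} (α : ℝ) (v : Covariate d) (p : Sample d) : ℝ :=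
  (1 + α) / 2 * gaussianShiftDensity (if p.1 = 0 then v else -v) p.2 +
    (1 - α) / 2 * gaussianShiftDensity (if p.1 = 0 then -v else v) p.2

lemma measurable_symmDensity {d : ℕ} (α : ℝ) (v : Covariate d) :
    Measurable (symmDensity α v) := by
  have h : ∀ a b : Covariate d,
      Measurable fun p : Sample d => gaussianShiftDensity (if p.1 = 0 then a else b) p.2 := by
    intro a b
    have h0 : Measurable fun y : Fin 2 => if y = 0 then a else b := measurable_of_finite _
    have h1 : Measurable fun p : Sample d => if p.1 = 0 then a else b := h0.comp measurable_fst
    unfold gaussianShiftDensity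
    exact ((h1.inner measurable_snd).sub ((h1.norm.pow_const 2).div_const 2)).exp
  unfold symmDensity
  exact ((h _ _).const_mul _).add ((h _ _).const_mul _)

lemma symmDensity_mk {d : ℕ} (α : ℝ) (v : Covariate d) (y : Fin 2) (x : Covariate d) :
    symmDensity α v (y, x) = (1 + α) / 2 * gaussianShiftDensity (if y = 0 then v else -v) x +
      (1 - α) / 2 * gaussianShiftDensity (if y = 0 then -v else v) x :=
  rfl

lemma integrable_symmDensity {d : ℕ} (α : ℝ) (v : Covariate d) (y : Fin 2) :
    Integrable (fun x => symmDensity α v (y, x)) (multivariateGaussian (0 : Covariate d) 1) := by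
  simp_rw [symmDensity_mk]
  exact ((integrable_gaussianShiftDensity _).const_mul _).add
    ((integrable_gaussianShiftDensity _).const_mul _)

lemma symmDensity_mul {d : ℕ} (α : ℝ) (u v : Covariate d) (y : Fin 2) (x : Covariate d) :
    symmDensity α u (y, x) * symmDensity α v (y, x) =
      ((1 + α) / 2) ^ 2 * (gaussianShiftDensity (if y = 0 then u else -u) x *
        gaussianShiftDensity (if y = 0 then v else -v) x) +
      (1 + α) / 2 * ((1 - α) / 2) * (gaussianShiftDensity (if y = 0 then u else -u) x *
        gaussianShiftDensity (if y = 0 then -v else v) x) +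
      ((1 + α) / 2 * ((1 - α) / 2) * (gaussianShiftDensity (if y = 0 then -u else u) x *
        gaussianShiftDensity (if y = 0 then v else -v) x) +
      ((1 - α) / 2) ^ 2 * (gaussianShiftDensity (if y = 0 then -u else u) x *
        gaussianShiftDensity (if y = 0 then -v else v) x)) := by
  simp only [symmDensity_mk]
  ring

lemma integrable_symmDensity_mul {d : ℕ} (α : ℝ) (u v : Covariate d) (y : Fin 2) :
    Integrable (fun x => symmDensity α u (y, x) * symmDensity α v (y, x))
      (multivariateGaussian (0 : Covariate d) 1) := by
  simp_rw [symmDensity_mul]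
  exact (((integrable_gaussianShiftDensity_mul _ _).const_mul _).add
    ((integrable_gaussianShiftDensity_mul _ _).const_mul _)).add
    (((integrable_gaussianShiftDensity_mul _ _).const_mul _).add
    ((integrable_gaussianShiftDensity_mul _ _).const_mul _))

lemma memLp_symmDensity {d : ℕ} (α : ℝ) (v : Covariate d) :
    MemLp (symmDensity α v) 2 (symmParam 1 α 0).law := by
  have hm := measurable_symmDensity α v
  refine (memLp_two_iff_integrable_sq hm.aestronglyMeasurable).2 ?_
  refine integrable_law _ (hm.pow_const 2) fun y z => ?_
  rw [symmParam_zero_mean]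
  simp_rw [sq]
  exact integrable_symmDensity_mul α v v y

lemma integral_symmDensity {d : ℕ} {α : ℝ} (hα : α ∈ Set.Icc (0 : ℝ) 1) (v : Covariate d) :
    ∫ p, symmDensity α v p ∂(symmParam 1 α 0).law = 1 := by
  have h : ∀ y : Fin 2, ∫ x, symmDensity α v (y, x) ∂multivariateGaussian (0 : Covariate d) 1 = 1 := by
    intro y
    have hi : ∀ (c : ℝ) (a : Covariate d), Integrable (fun x => c * gaussianShiftDensity a x)
        (multivariateGaussian (0 : Covariate d) 1) := fun c a =>
      (integrable_gaussianShiftDensity _).const_mul _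
    simp_rw [symmDensity_mk]
    rw [integral_add (hi _ _) (hi _ _), integral_const_mul, integral_const_mul,
      integral_gaussianShiftDensity, integral_gaussianShiftDensity]
    ring
  rw [integral_law_symmParam_zero hα (measurable_symmDensity α v) (integrable_symmDensity α v),
    h, h]
  norm_num

/-- Expanding gives four products of shifts. Those with equal signs have total weight `(1 + α²)/2`
and integral `exp ⟨u, v⟩`; those with opposite signs have total weight `(1 - α²)/2` and integral
`exp (-⟨u, v⟩)`. The label thus contributes only the odd part, damped by `α²`. -/
lemma integral_symmDensity_mul {d : ℕ} {α : ℝ} (hα : α ∈ Set.Icc (0 : ℝ) 1) (u v : Covariate d) :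
    ∫ p, symmDensity α u p * symmDensity α v p ∂(symmParam 1 α 0).law =
      Real.cosh (inner ℝ u v) + α ^ 2 * Real.sinh (inner ℝ u v) := by
  have h : ∀ y : Fin 2, ∫ x, symmDensity α u (y, x) * symmDensity α v (y, x)
      ∂multivariateGaussian (0 : Covariate d) 1 =
      Real.cosh (inner ℝ u v) + α ^ 2 * Real.sinh (inner ℝ u v) := by
    intro y
    have hi : ∀ (c : ℝ) (a b : Covariate d), Integrable (fun x => c * (gaussianShiftDensity a x *
        gaussianShiftDensity b x)) (multivariateGaussian (0 : Covariate d) 1) := fun c a b =>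
      (integrable_gaussianShiftDensity_mul _ _).const_mul _
    have hi2 : ∀ (c c' : ℝ) (a b a' b' : Covariate d), Integrable (fun x =>
        c * (gaussianShiftDensity a x * gaussianShiftDensity b x) +
        c' * (gaussianShiftDensity a' x * gaussianShiftDensity b' x))
        (multivariateGaussian (0 : Covariate d) 1) := fun c c' a b a' b' =>
      (hi c a b).add (hi c' a' b')
    simp_rw [symmDensity_mul]
    rw [integral_add (hi2 _ _ _ _ _ _) (hi2 _ _ _ _ _ _),
      integral_add (hi _ _ _) (hi _ _ _), integral_add (hi _ _ _) (hi _ _ _)]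
    simp only [integral_const_mul, integral_gaussianShiftDensity_mul]
    rw [Real.cosh_eq, Real.sinh_eq]
    by_cases hy : y = 0 <;> simp [hy, inner_neg_left, inner_neg_right] <;> ring
  have hm : Measurable fun p => symmDensity α u p * symmDensity α v p :=
    (measurable_symmDensity α u).mul (measurable_symmDensity α v)
  rw [integral_law_symmParam_zero hα hm
    (integrable_symmDensity_mul α u v), h, h]
  ring

lemma Query.mean_symmParam {d : ℕ} {M α : ℝ} (hα : α ∈ Set.Icc (0 : ℝ) 1) (q : Query d M)
    (v : Covariate d) :
    q.mean (symmParam 1 α v) = ∫ p, q.1 p * symmDensity α v p ∂(symmParam 1 α 0).law := by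
  have hq : ∀ y : Fin 2, Measurable fun x => q.1 (y, x) := fun y =>
    q.2.1.comp (by fun_prop)
  have hi : ∀ (y : Fin 2) (a : Covariate d), Integrable (fun x => q.1 (y, x) *
      gaussianShiftDensity a x) (multivariateGaussian (0 : Covariate d) 1) := fun y a =>
    (integrable_gaussianShiftDensity a).bdd_mul (hq y).aestronglyMeasurable
      (ae_of_all _ fun x => by simpa using q.2.2 (y, x))
  have hs : ∀ (y : Fin 2) x, q.1 (y, x) * symmDensity α v (y, x) =
      (1 + α) / 2 * (q.1 (y, x) * gaussianShiftDensity (if y = 0 then v else -v) x) +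
      (1 - α) / 2 * (q.1 (y, x) * gaussianShiftDensity (if y = 0 then -v else v) x) := by
    intro y x
    simp only [symmDensity_mk]
    ring
  have hsi : ∀ y : Fin 2, Integrable (fun x => q.1 (y, x) * symmDensity α v (y, x))
      (multivariateGaussian (0 : Covariate d) 1) := by
    intro y
    simp_rw [hs]
    exact ((hi _ _).const_mul _).add ((hi _ _).const_mul _)
  have hsv : ∀ y : Fin 2, ∫ x, q.1 (y, x) * symmDensity α v (y, x)
      ∂multivariateGaussian (0 : Covariate d) 1 =
      (1 + α) / 2 * ∫ x, q.1 (y, x) ∂multivariateGaussian (if y = 0 then v else -v) 1 +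
      (1 - α) / 2 * ∫ x, q.1 (y, x) ∂multivariateGaussian (if y = 0 then -v else v) 1 := by
    intro y
    simp_rw [hs]
    rw [integral_add ((hi _ _).const_mul _) ((hi _ _).const_mul _), integral_const_mul,
      integral_const_mul, ← integral_multivariateGaussian_one, ← integral_multivariateGaussian_one]
  have hm : Measurable fun p => q.1 p * symmDensity α v p :=
    q.2.1.mul (measurable_symmDensity α v)
  rw [integral_law_symmParam_zero hα hm hsi, hsv, hsv,
    Query.mean, integral_law _ hα q.2.1 fun y z =>
      Integrable.of_bound (hq y).aestronglyMeasurable M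
        (ae_of_all _ fun x => by simpa using q.2.2 (y, x))]
  simp [symmParam, Fin.sum_univ_two]
  ring

/-- The pairwise correlation of two alternatives with overlap `t`. -/
def pairCorr (α t : ℝ) : ℝ := Real.cosh t - 1 + α ^ 2 * Real.sinh t

lemma sinh_le_mul_exp (t : ℝ) : Real.sinh t ≤ t * Real.exp t := by
  have h1 : 1 - 2 * t ≤ Real.exp (-(2 * t)) := by
    have := Real.add_one_le_exp (-(2 * t)); linarith
  have h2 : Real.exp (-t) = Real.exp (-(2 * t)) * Real.exp t := by
    rw [← Real.exp_add]; congr 1; ring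
  rw [Real.sinh_eq, h2]
  nlinarith [Real.exp_pos t]

/-- Follows from `cosh t - 1 = 2 sinh² (t/2)` and the preceding bound on `sinh`. -/
lemma cosh_sub_one_le {t : ℝ} (ht : 0 ≤ t) : Real.cosh t - 1 ≤ t ^ 2 * Real.exp t := by
  have h1 : Real.cosh t = 1 + 2 * Real.sinh (t / 2) ^ 2 := by
    have := Real.cosh_two_mul (t / 2)
    rw [mul_div_cancel₀ _ two_ne_zero, Real.cosh_sq] at this
    linarith
  have h2 := sinh_le_mul_exp (t / 2)
  have h3 : 0 ≤ Real.sinh (t / 2) := Real.sinh_nonneg_iff.2 (by positivity)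
  have h4 : (t / 2 * Real.exp (t / 2)) ^ 2 = t ^ 2 / 4 * Real.exp t := by
    rw [mul_pow, ← Real.exp_nat_mul]; congr 2 <;> [ring; (push_cast; ring)]
  have h5 := pow_le_pow_left₀ h3 h2 2
  rw [h4] at h5
  nlinarith [mul_nonneg (sq_nonneg t) (Real.exp_pos t).le]

/-- This separates the signal strength, which the rate controls, from the overlap, which is
controlled by counting. The extra `2` in the exponent absorbs `k²`. The exact zero at `k = 0` is
what makes typical pairs free. -/
lemma abs_pairCorr_mul_nat_le {α b : ℝ} (hb : 0 ≤ b) (k : ℕ) :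
    |pairCorr α (b * k)| ≤
      (b ^ 2 + α ^ 2 * b) * if k = 0 then 0 else Real.exp ((b + 2) * k) := by
  rcases Nat.eq_zero_or_pos k with rfl | hk
  · simp [pairCorr]
  rw [if_neg hk.ne']
  have hk1 : (1 : ℝ) ≤ k := by exact_mod_cast hk
  have ht : 0 ≤ b * k := by positivity
  have h0 : 0 ≤ pairCorr α (b * k) := by
    have := Real.one_le_cosh (b * k)
    have := Real.sinh_nonneg_iff.2 ht
    unfold pairCorr
    nlinarith [sq_nonneg α, mul_nonneg (sq_nonneg α) this]
  rw [abs_of_nonneg h0, pairCorr]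
  have hs := sinh_le_mul_exp (b * k)
  have hc := cosh_sub_one_le ht
  have hke : (k : ℝ) ^ 2 ≤ Real.exp (2 * k) := by
    have : (k : ℝ) ≤ Real.exp k := by linarith [Real.add_one_le_exp (k : ℝ)]
    calc (k : ℝ) ^ 2 ≤ Real.exp k ^ 2 := by gcongr
      _ = Real.exp (2 * k) := by rw [← Real.exp_nat_mul]; norm_num
  have he : Real.exp ((b + 2) * k) = Real.exp (2 * k) * Real.exp (b * k) := by
    rw [← Real.exp_add]; congr 1; ring
  have hE := Real.exp_pos (b * k)
  calc Real.cosh (b * k) - 1 + α ^ 2 * Real.sinh (b * k)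
      ≤ (b * k) ^ 2 * Real.exp (b * k) + α ^ 2 * (b * k * Real.exp (b * k)) := by gcongr
    _ = (b ^ 2 * k ^ 2 + α ^ 2 * b * k) * Real.exp (b * k) := by ring
    _ ≤ (b ^ 2 * k ^ 2 + α ^ 2 * b * k ^ 2) * Real.exp (b * k) := by
        gcongr
        nlinarith
    _ = (b ^ 2 + α ^ 2 * b) * (k ^ 2 * Real.exp (b * k)) := by ring
    _ ≤ (b ^ 2 + α ^ 2 * b) * Real.exp ((b + 2) * k) := by
        rw [he]; gcongr

/-! ### Sparse alternatives -/

/-- The number of arguments at which `f` and `g` agree. -/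
def agreement {s D : ℕ} (f g : Fin s → Fin D) : ℕ :=
  (Finset.univ.filter fun i => f i = g i).card

/-- The sum factorizes over the blocks; in each, one choice agrees with `f` and `D - 1` choices do
not. -/
lemma sum_pow_agreement {s D : ℕ} (f : Fin s → Fin D) (x : ℝ) :
    ∑ g : Fin s → Fin D, x ^ agreement f g = (x + (D - 1)) ^ s := by
  have h1 : ∀ g : Fin s → Fin D, x ^ agreement f g = ∏ i, if f i = g i then x else 1 := by
    intro g
    rw [agreement, Finset.prod_ite]
    simp
  have h2 : ∀ i : Fin s, ∑ j : Fin D, (if f i = j then x else 1) = x + (D - 1) := by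
    intro i
    rw [← Finset.add_sum_erase _ _ (Finset.mem_univ (f i)), if_pos rfl]
    congr 1
    rw [Finset.sum_congr rfl fun j hj => if_neg (Finset.ne_of_mem_erase hj).symm]
    have hD : 1 ≤ D := (f i).pos
    simp [Finset.card_erase_of_mem, Nat.cast_sub hD]
  simp_rw [h1]
  rw [← Fintype.piFinset_univ, ← Finset.prod_univ_sum (fun _ => Finset.univ)
    (fun i j => if f i = j then x else 1), Finset.prod_congr rfl fun i _ => h2 i]
  simp

/-- An exponential moment of the overlap with a uniformly chosen alternative: it is at most `exp (s
x / D) ≤ e ≤ 3`. -/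
lemma sum_pow_agreement_le {s D : ℕ} (f : Fin s → Fin D) {x : ℝ} (hx : 0 ≤ x) (hD : 1 ≤ D)
    (hsx : s * x ≤ D) : ∑ g : Fin s → Fin D, x ^ agreement f g ≤ 3 * (D : ℝ) ^ s := by
  have hD0 : (1 : ℝ) ≤ D := by exact_mod_cast hD
  have hDp : (0 : ℝ) < D := by linarith
  rw [sum_pow_agreement]
  have h1 : x + (D - 1) ≤ Real.exp (x / D) * D := by
    have := Real.add_one_le_exp (x / D)
    have h2 : (x / D + 1) * D = x + D := by field_simp
    nlinarith
  calc (x + (D - 1)) ^ s ≤ (Real.exp (x / D) * D) ^ s := by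
        gcongr
    _ = Real.exp (s * (x / D)) * (D : ℝ) ^ s := by rw [mul_pow, ← Real.exp_nat_mul]
    _ ≤ 3 * (D : ℝ) ^ s := by
        gcongr
        calc Real.exp (s * (x / D)) ≤ Real.exp 1 := by
              rw [Real.exp_le_exp, ← mul_div_assoc]
              exact div_le_one_of_le₀ hsx hDp.le
          _ ≤ 3 := by linarith [Real.exp_one_lt_d9]

/-- The position in the `i`-th of `s` disjoint blocks of `D` coordinates. -/
def blockIndex {d s D : ℕ} (h : s * D ≤ d) (i : Fin s) (j : Fin D) : Fin d :=
  Fin.castLE h (finProdFinEquiv (i, j))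

lemma blockIndex_inj {d s D : ℕ} (h : s * D ≤ d) {i i' : Fin s} {j j' : Fin D} :
    blockIndex h i j = blockIndex h i' j' ↔ i = i' ∧ j = j' := by
  rw [blockIndex, blockIndex, Fin.castLE_inj, EmbeddingLike.apply_eq_iff_eq, Prod.mk.injEq]

/-- The vector with one entry `c` in each of the `s` blocks, at the position chosen by `f`. -/
def blockVector {d s D : ℕ} (h : s * D ≤ d) (c : ℝ) (f : Fin s → Fin D) : Covariate d :=
  ∑ i, EuclideanSpace.single (blockIndex h i (f i)) c

lemma inner_blockVector {d s D : ℕ} (h : s * D ≤ d) (c : ℝ) (f g : Fin s → Fin D) :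
    inner ℝ (blockVector h c f) (blockVector h c g) = c ^ 2 * agreement f g := by
  rw [blockVector, blockVector, sum_inner]
  have h1 : ∀ i : Fin s, inner ℝ (EuclideanSpace.single (blockIndex h i (f i)) c)
      (∑ j, EuclideanSpace.single (blockIndex h j (g j)) c) =
      c ^ 2 * if f i = g i then 1 else 0 := by
    intro i
    rw [inner_sum, Finset.sum_eq_single i]
    · by_cases hfg : f i = g i
      · simp [hfg, sq]
      · simp [hfg, EuclideanSpace.inner_single_left, blockIndex_inj]
    · intro j _ hj
      simp [EuclideanSpace.inner_single_left, blockIndex_inj, hj.symm]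
    · simp
  rw [Finset.sum_congr rfl fun i _ => h1 i, ← Finset.mul_sum]
  simp [agreement]

lemma card_support_blockVector_le {d s D : ℕ} (h : s * D ≤ d) (c : ℝ) (f : Fin s → Fin D) :
    (Finset.univ.filter fun j => blockVector h c f j ≠ 0).card ≤ s := by
  have hsub : (Finset.univ.filter fun j => blockVector h c f j ≠ 0) ⊆
      Finset.univ.image fun i => blockIndex h i (f i) := by
    intro j hj
    by_contra hn
    refine (Finset.mem_filter.1 hj).2 ?_
    simp only [Finset.mem_image, Finset.mem_univ, true_and, not_exists] at hn
    rw [blockVector, WithLp.ofLp_sum, Finset.sum_apply]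
    refine Finset.sum_eq_zero fun i _ => ?_
    simp [Ne.symm (hn i)]
  refine (Finset.card_le_card hsub).trans (Finset.card_image_le.trans ?_)
  simp

/-- The mean difference is `2v` and `v` has `s` entries of square `γ/(4s)`, so the signal-to-noise
ratio is exactly `γ`. -/
lemma symmParam_blockVector_mem_altSpace {d s D : ℕ} (h : s * D ≤ d) (hs : 1 ≤ s) (α : ℝ)
    {γ : ℝ} (hγ : 0 ≤ γ) (f : Fin s → Fin D) :
    symmParam 1 α (blockVector h (Real.sqrt (γ / (4 * s))) f) ∈ altSpace 1 α s γ := by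
  set v := blockVector h (Real.sqrt (γ / (4 * s))) f with hv
  have hs0 : (0 : ℝ) < s := by exact_mod_cast hs
  have hdiff : (symmParam 1 α v).diff = fun j => 2 * v j := by
    ext j
    simp [Param.diff, symmParam]
    ring
  refine ⟨⟨rfl, rfl⟩, ?_, ?_⟩
  · rw [hdiff]
    simpa using card_support_blockVector_le h _ f
  · have h1 : inner ℝ v v = γ / (4 * s) * s := by
      rw [hv, inner_blockVector, Real.sq_sqrt (by positivity)]
      simp [agreement]
    have h2 : (symmParam 1 α v).snr = 4 * inner ℝ v v := by
      rw [Param.snr, hdiff]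
      simp only [symmParam, inv_one, Matrix.one_mulVec, dotProduct, PiLp.inner_apply,
        RCLike.inner_apply, conj_trivial, Finset.mul_sum]
      exact Finset.sum_congr rfl fun j _ => by ring
    rw [h2, h1]
    field_simp
    exact le_refl _

/-! ### Few alternatives are detected by one query -/

lemma Query.abs_mean_le {d : ℕ} {M : ℝ} (q : Query d M) (θ : Param d)
    (hα : θ.sup ∈ Set.Icc (0 : ℝ) 1) : |q.mean θ| ≤ M := by
  have := isProbabilityMeasure_law θ hα
  have h := norm_integral_le_of_norm_le_const (μ := θ.law) (f := q.1) (C := M)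
    (ae_of_all _ fun p => by simpa using q.2.2 p)
  simpa [Query.mean] using h

lemma tolerance_nonneg (η ξ M : ℝ) (n : ℕ) (e : ℝ) : 0 ≤ tolerance η ξ M n e :=
  le_max_of_le_right (Real.sqrt_nonneg _)

/-- A deviation beyond the tolerance at `e` is also large relative to the variance at `e₀`. -/
lemma deviation_sq_gt_of_tolerance_lt {η ξ M e e₀ : ℝ} {n : ℕ} (hn : 1 ≤ n) (hM : 0 < M)
    (hL : 0 ≤ η + Real.log (1 / ξ)) (he : |e| ≤ M) (he₀ : |e₀| ≤ M)
    (h : tolerance η ξ M n e < |e₀ - e|) :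
    2 / 5 * (η + Real.log (1 / ξ)) / n * (M ^ 2 - e₀ ^ 2) < |e₀ - e| ^ 2 ∧
      η + Real.log (1 / ξ) < 2 * n := by
  set L := η + Real.log (1 / ξ) with hLdef
  have hn0 : (0 : ℝ) < n := by exact_mod_cast hn
  set D := |e₀ - e| with hD
  have hD0 : 0 ≤ D := abs_nonneg _
  have h1 : L * M / n < D := (le_max_left _ _).trans_lt h
  have h2 : 2 * L * (M ^ 2 - e ^ 2) / n < D ^ 2 := by
    have h3 := (le_max_right _ _).trans_lt h
    rwa [Real.sqrt_lt' ((Real.sqrt_nonneg _).trans_lt h3)] at h3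
  have hD2 : D ≤ 2 * M := by
    have := abs_sub e₀ e
    linarith
  have h4 : M ^ 2 - e₀ ^ 2 ≤ M ^ 2 - e ^ 2 + 2 * M * D := by
    have h5 : (e - e₀) * (e + e₀) ≤ D * (2 * M) := by
      calc (e - e₀) * (e + e₀) ≤ |(e - e₀) * (e + e₀)| := le_abs_self _
        _ = |e₀ - e| * |e + e₀| := by rw [abs_mul, abs_sub_comm]
        _ ≤ D * (2 * M) := by
            gcongr
            have := abs_add_le e e₀
            linarith
    nlinarith
  constructor
  · have h6 : L / n * (M ^ 2 - e₀ ^ 2) ≤ L / n * (M ^ 2 - e ^ 2 + 2 * M * D) := by gcongr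
    have h7 : L / n * (M ^ 2 - e ^ 2 + 2 * M * D) =
        2 * L * (M ^ 2 - e ^ 2) / n / 2 + 2 * ((L * M / n) * D) := by
      field_simp
    have h8 : L * M / n * D ≤ D * D := by gcongr
    have h9 : 2 / 5 * L / n * (M ^ 2 - e₀ ^ 2) = 2 / 5 * (L / n * (M ^ 2 - e₀ ^ 2)) := by ring
    rw [h9]
    nlinarith
  · rw [div_lt_iff₀ hn0] at h1
    by_contra hc
    push Not at hc
    nlinarith

/-- The alternatives for which the answer to `q` has to differ from the answer under the null. -/
def detected {d s D : ℕ} {M : ℝ} (h : s * D ≤ d) (c η ξ α : ℝ) (n : ℕ) (q : Query d M) :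
    Finset (Fin s → Fin D) := by
  classical
  exact Finset.univ.filter fun f =>
    tolerance η ξ M n (q.mean (symmParam 1 α (blockVector h c f))) <
      |q.mean (symmParam 1 α 0) - q.mean (symmParam 1 α (blockVector h c f))|

lemma mem_detected {d s D : ℕ} {M : ℝ} {h : s * D ≤ d} {c η ξ α : ℝ} {n : ℕ} {q : Query d M}
    {f : Fin s → Fin D} : f ∈ detected h c η ξ α n q ↔
      tolerance η ξ M n (q.mean (symmParam 1 α (blockVector h c f))) <
        |q.mean (symmParam 1 α 0) - q.mean (symmParam 1 α (blockVector h c f))| := by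
  simp [detected]

/-- Overlaps below `k₀` cost at most `G` each. For `k ≥ k₀`, a Markov-type bound `exp ((b+2)k) ≤ y ^
k ≤ (y ^ 2) ^ k / y ^ k₀` reduces to the exponential moment of the overlap. The choice `G = 0`, `k₀
= 1` is allowed because zero overlap costs nothing. -/
lemma sum_abs_pairCorr_agreement_le {s D : ℕ} (hD : 1 ≤ D) {α b y G : ℝ} {k₀ : ℕ}
    (hb : 0 ≤ b) (hy : 1 ≤ y) (hsy : s * y ^ 2 ≤ D) (hby : Real.exp (b + 2) ≤ y) (hG : 0 ≤ G)
    (hbG : ∀ k : ℕ, 1 ≤ k → k < k₀ → Real.exp ((b + 2) * k) ≤ G)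
    (C : Finset (Fin s → Fin D)) (f : Fin s → Fin D) :
    ∑ g ∈ C, |pairCorr α (b * agreement f g)| ≤
      (b ^ 2 + α ^ 2 * b) * (G * C.card + 3 * (D : ℝ) ^ s / y ^ k₀) := by
  have hy0 : 0 < y := by linarith
  have hterm : ∀ k : ℕ, (if k = 0 then 0 else Real.exp ((b + 2) * k)) ≤
      G + (y ^ 2) ^ k / y ^ k₀ := by
    intro k
    split_ifs with hk
    · positivity
    rcases lt_or_ge k k₀ with hlt | hge
    · exact (hbG k (Nat.one_le_iff_ne_zero.2 hk) hlt).trans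
        (le_add_of_nonneg_right (by positivity))
    · refine le_add_of_nonneg_of_le hG ?_
      rw [le_div_iff₀ (by positivity)]
      calc Real.exp ((b + 2) * k) * y ^ k₀ ≤ y ^ k * y ^ k := by
            gcongr
            · rw [mul_comm, Real.exp_nat_mul]
              gcongr
        _ = (y ^ 2) ^ k := by rw [← pow_add, ← pow_mul]; congr 1; ring
  have hH : 0 ≤ b ^ 2 + α ^ 2 * b := by positivity
  calc ∑ g ∈ C, |pairCorr α (b * agreement f g)|
      ≤ ∑ g ∈ C, (b ^ 2 + α ^ 2 * b) * (G + (y ^ 2) ^ agreement f g / y ^ k₀) :=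
        Finset.sum_le_sum fun g _ => (abs_pairCorr_mul_nat_le hb _).trans
          (mul_le_mul_of_nonneg_left (hterm _) hH)
    _ = (b ^ 2 + α ^ 2 * b) * (G * C.card + (∑ g ∈ C, (y ^ 2) ^ agreement f g) / y ^ k₀) := by
        rw [← Finset.mul_sum, Finset.sum_add_distrib, Finset.sum_const, nsmul_eq_mul,
          Finset.sum_div, mul_comm G]
    _ ≤ (b ^ 2 + α ^ 2 * b) * (G * C.card + 3 * (D : ℝ) ^ s / y ^ k₀) := by
        gcongr
        exact (Finset.sum_le_sum_of_subset_of_nonneg (Finset.subset_univ C)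
          fun g _ _ => by positivity).trans (sum_pow_agreement_le f (by positivity) hD hsy)

/-- If a positive proportion `p` of the alternatives is detected by one query, the tolerance is
small relative to the pairwise correlations of the alternatives. -/
lemma lt_of_le_card_detected {d s D n : ℕ} {M α c η ξ y G p : ℝ} {k₀ : ℕ} (h : s * D ≤ d)
    (hD : 1 ≤ D) (hn : 1 ≤ n) (hM : 0 < M) (hα : α ∈ Set.Icc (0 : ℝ) 1)
    (hL : 0 ≤ η + Real.log (1 / ξ))
    (hy : 1 ≤ y) (hsy : s * y ^ 2 ≤ D) (hby : Real.exp (c ^ 2 + 2) ≤ y)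
    (hG : 0 ≤ G) (hbG : ∀ k : ℕ, 1 ≤ k → k < k₀ → Real.exp ((c ^ 2 + 2) * k) ≤ G) (hp : 0 < p)
    (q : Query d M)
    (hcard : p * (D : ℝ) ^ s ≤ (detected h c η ξ α n q).card) :
    2 / 5 * (η + Real.log (1 / ξ)) / n <
        ((c ^ 2) ^ 2 + α ^ 2 * c ^ 2) * (G + 3 / p / y ^ k₀) ∧
      η + Real.log (1 / ξ) < 2 * n := by
  set C := detected h c η ξ α n q with hC
  set L := η + Real.log (1 / ξ) with hLdef
  have hD0 : (0 : ℝ) < D := by exact_mod_cast hD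
  have hn0 : (0 : ℝ) < n := by exact_mod_cast hn
  have hCpos : (0 : ℝ) < C.card := lt_of_lt_of_le (by positivity) hcard
  have hCne : C.Nonempty := Finset.card_pos.1 (by exact_mod_cast hCpos)
  set e : (Fin s → Fin D) → ℝ := fun f => q.mean (symmParam 1 α (blockVector h c f)) with he
  set e₀ := q.mean (symmParam 1 α 0) with he₀
  have heM : ∀ f, |e f| ≤ M := fun f => q.abs_mean_le _ hα
  have he₀M : |e₀| ≤ M := q.abs_mean_le _ hα
  have hdev := fun f (hf : f ∈ C) => deviation_sq_gt_of_tolerance_lt hn hM hL (heM f) he₀M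
    (mem_detected.1 hf)
  refine ⟨?_, (hdev _ hCne.choose_spec).2⟩
  have := isProbabilityMeasure_law (symmParam (1 : Matrix (Fin d) (Fin d) ℝ) α 0) hα
  have hcs := sq_sum_abs_integral_sub_le (P := (symmParam (1 : Matrix (Fin d) (Fin d) ℝ) α 0).law)
    q.2.1 q.2.2
    (w := fun f => symmDensity α (blockVector h c f)) (fun f => memLp_symmDensity α _)
    (fun f => integral_symmDensity hα _)
    (h := fun f g => pairCorr α (c ^ 2 * agreement f g))
    (fun f g => by rw [integral_symmDensity_mul hα, inner_blockVector, pairCorr]; ring) C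
  have hV0 : 0 ≤ M ^ 2 - e₀ ^ 2 := by nlinarith [abs_le.1 he₀M, sq_abs e₀, abs_nonneg e₀]
  set V := M ^ 2 - e₀ ^ 2 with hVdef
  set κ := 2 / 5 * L / n with hκ
  have hκ0 : 0 ≤ κ := by positivity
  have hlow : (C.card : ℝ) ^ 2 * (κ * V) < (∑ f ∈ C, |e f - e₀|) ^ 2 := by
    have h1 : ∑ f ∈ C, Real.sqrt (κ * V) < ∑ f ∈ C, |e f - e₀| := by
      refine Finset.sum_lt_sum_of_nonempty hCne fun f hf => ?_
      rw [abs_sub_comm]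
      have h2 := (hdev f hf).1
      by_contra hcon
      push Not at hcon
      have h3 := pow_le_pow_left₀ (abs_nonneg _) hcon 2
      rw [Real.sq_sqrt (by positivity)] at h3
      exact absurd h2 (not_lt.2 h3)
    rw [Finset.sum_const, nsmul_eq_mul] at h1
    have h4 := pow_lt_pow_left₀ h1 (by positivity) two_ne_zero
    rwa [mul_pow, Real.sq_sqrt (by positivity)] at h4
  have hup : (∑ f ∈ C, |e f - e₀|) ^ 2 ≤
      V * ∑ f ∈ C, ∑ g ∈ C, |pairCorr α (c ^ 2 * agreement f g)| := by
    refine le_trans (le_of_eq ?_) hcs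
    congr 1
    refine Finset.sum_congr rfl fun f _ => ?_
    rw [he]
    simp only [q.mean_symmParam hα]
    rfl
  -- If the null mean is `M` or `-M`, the second moment bound forbids any deviation, contradicting
  -- detection.
  have hVpos : 0 < V := by
    rcases hV0.lt_or_eq with h0 | h0
    · exact h0
    · rw [← h0] at hup hlow
      simp only [mul_zero, zero_mul] at hup hlow
      linarith
  have hsum := sum_abs_pairCorr_agreement_le (α := α) hD (sq_nonneg c) hy hsy hby hG hbG C
  have hsum2 : ∑ f ∈ C, ∑ g ∈ C, |pairCorr α (c ^ 2 * agreement f g)| ≤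
      C.card * (((c ^ 2) ^ 2 + α ^ 2 * c ^ 2) * (G * C.card + 3 * (D : ℝ) ^ s / y ^ k₀)) := by
    rw [← nsmul_eq_mul, ← Finset.sum_const]
    exact Finset.sum_le_sum fun f _ => hsum f
  have hH : 0 ≤ (c ^ 2) ^ 2 + α ^ 2 * c ^ 2 := by positivity
  have hyk : 0 < y ^ k₀ := by positivity
  have hfin : 3 * (D : ℝ) ^ s / y ^ k₀ ≤ C.card * (3 / p / y ^ k₀) := by
    rw [div_le_iff₀ hyk]
    have : (C.card : ℝ) * (3 / p / y ^ k₀) * y ^ k₀ = 3 * (C.card / p) := by field_simp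
    rw [this]
    have : (D : ℝ) ^ s ≤ C.card / p := by rw [le_div_iff₀ hp]; linarith
    linarith
  have hchain : (C.card : ℝ) ^ 2 * (κ * V) < V * (C.card * (((c ^ 2) ^ 2 + α ^ 2 * c ^ 2) *
      (G * C.card + C.card * (3 / p / y ^ k₀)))) := by
    refine hlow.trans_le (hup.trans ?_)
    gcongr
    exact hsum2.trans (by gcongr)
  have hpos : 0 < V * (C.card : ℝ) ^ 2 := by positivity
  refine lt_of_mul_lt_mul_left (a := V * (C.card : ℝ) ^ 2) ?_ hpos.le
  calc V * (C.card : ℝ) ^ 2 * κ = (C.card : ℝ) ^ 2 * (κ * V) := by ring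
    _ < _ := hchain
    _ = _ := by ring

/-! ### The oracle that imitates the null hypothesis -/

/-- The deterministic oracle that answers as under zero means whenever this is admissible. -/
def nullOracle {d : ℕ} {M : ℝ} (η ξ α : ℝ) (n : ℕ) (S : Matrix (Fin d) (Fin d) ℝ) :
    SQOracle d M where
  Ω := Unit
  prob _ := Measure.dirac ()
  answer θ q _ :=
    -- For `ξ = 0` and for `ξ ≥ 1/2` the tolerance requirement is vacuous, so the null answer is
    -- always allowed.
    if 0 < ξ ∧ ξ < 1 / 2 ∧ tolerance η ξ M n (q.mean θ) < |q.mean (symmParam S α 0) - q.mean θ|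
    then q.mean θ else q.mean (symmParam S α 0)

lemma nullOracle_answer_null {d : ℕ} {M : ℝ} (η ξ α : ℝ) (n : ℕ)
    (S : Matrix (Fin d) (Fin d) ℝ) (q : Query d M) (ω : (nullOracle η ξ α n S : SQOracle d M).Ω) :
    (nullOracle η ξ α n S).answer (symmParam S α 0) q ω = q.mean (symmParam S α 0) := by
  simp [nullOracle]

lemma SQAlgorithm.measurable_mean_next {d : ℕ} {M : ℝ} (A : SQAlgorithm d M) (θ : Param d)
    (t : ℕ) : Measurable fun p : A.Seed × (Fin t → ℝ) => (A.next t p.1 p.2).mean θ :=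
  ((A.measurable_next t).stronglyMeasurable.integral_prod_right' (ν := θ.law)).measurable

lemma measurable_tolerance (η ξ M : ℝ) (n : ℕ) : Measurable (tolerance η ξ M n) := by
  unfold tolerance
  fun_prop

/-- Each answer is a measurable function of two expectations of the adaptively chosen query, and
these depend measurably on the seed as parameter integrals of a jointly measurable function. -/
lemma measurable_answers_nullOracle {d : ℕ} {M : ℝ} (A : SQAlgorithm d M) (η ξ α : ℝ) (n : ℕ)
    (S : Matrix (Fin d) (Fin d) ℝ) (θ : Param d) (ω : (nullOracle η ξ α n S : SQOracle d M).Ω)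
    (t : ℕ) :
    Measurable fun u : A.Seed =>
      A.answers u (fun q => (nullOracle η ξ α n S).answer θ q ω) t := by
  induction t with
  | zero => exact measurable_pi_iff.2 fun i => i.elim0
  | succ t ih =>
    refine measurable_pi_iff.2 fun i => ?_
    induction i using Fin.lastCases with
    | cast i =>
      simp only [SQAlgorithm.answers, Fin.snoc_castSucc]
      exact (measurable_pi_apply i).comp ih
    | last =>
      simp only [SQAlgorithm.answers, Fin.snoc_last]
      have h1 : Measurable fun u : A.Seed =>
          (u, A.answers u (fun q => (nullOracle η ξ α n S).answer θ q ω) t) :=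
        measurable_id.prodMk ih
      have h2 := (A.measurable_mean_next θ t).comp h1
      have h3 := (A.measurable_mean_next (symmParam S α 0) t).comp h1
      refine Measurable.ite ?_ h2 h3
      have h4 : MeasurableSet {u : A.Seed | tolerance η ξ M n ((A.next t u
          (A.answers u (fun q => (nullOracle η ξ α n S).answer θ q ω) t)).mean θ) <
          |(A.next t u (A.answers u (fun q => (nullOracle η ξ α n S).answer θ q ω) t)).mean
            (symmParam S α 0) - (A.next t u
          (A.answers u (fun q => (nullOracle η ξ α n S).answer θ q ω) t)).mean θ|} :=
        measurableSet_lt ((measurable_tolerance η ξ M n).comp h2) (h3.sub h2).abs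
      exact (MeasurableSet.const _).inter ((MeasurableSet.const _).inter h4)

lemma nullOracle_admissible {d : ℕ} {M : ℝ} (A : SQAlgorithm d M) (η ξ α : ℝ) (n : ℕ)
    (S : Matrix (Fin d) (Fin d) ℝ) :
    (nullOracle η ξ α n S : SQOracle d M).Admissible A η ξ n S α where
  measurable_answer θ _ q _ := measurable_const
  measurable_answers θ _ t :=
    (measurable_answers_nullOracle A η ξ α n S θ () t).comp measurable_fst
  within_tolerance hξ θ _ := by
    by_cases hξ2 : ξ < 1 / 2
    · refine le_trans (le_of_eq ?_) zero_le
      convert measure_empty (μ := (nullOracle η ξ α n S : SQOracle d M).prob θ)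
      refine Set.eq_empty_of_forall_notMem fun ω ⟨q, _, hq⟩ => ?_
      simp only [nullOracle] at hq
      split_ifs at hq with hc
      · rw [sub_self, abs_zero] at hq
        exact absurd hq (not_lt.2 (tolerance_nonneg _ _ _ _ _))
      · exact hc ⟨hξ, hξ2, hq⟩
    · refine prob_le_one.trans ?_
      rw [← ENNReal.ofReal_one]
      exact ENNReal.ofReal_le_ofReal (by linarith)

lemma transcriptProb_nullOracle {d : ℕ} {M : ℝ} (A : SQAlgorithm d M) (η ξ α : ℝ) (n : ℕ)
    (S : Matrix (Fin d) (Fin d) ℝ) (θ : Param d) {R : Set (A.Seed × (Fin A.rounds → ℝ))}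
    (hR : MeasurableSet R) :
    (nullOracle η ξ α n S).transcriptProb A θ R = A.seedLaw
      {u | (u, A.answers u (fun q => (nullOracle η ξ α n S).answer θ q ()) A.rounds) ∈ R} := by
  have hm : MeasurableSet {p : A.Seed × Unit |
      (p.1, A.answers p.1 (fun q => (nullOracle η ξ α n S).answer θ q p.2) A.rounds) ∈ R} := by
    refine Measurable.prodMk measurable_fst ?_ hR
    exact (measurable_answers_nullOracle A η ξ α n S θ () A.rounds).comp measurable_fst
  change (A.seedLaw.prod (Measure.dirac ())) _ = _
  rw [Measure.prod_dirac]
  exact Measure.map_apply (by fun_prop) hm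

/-- Two families of answers that agree on all queries asked under the first one lead to the same
transcript. -/
lemma SQAlgorithm.answers_congr {d : ℕ} {M : ℝ} (A : SQAlgorithm d M) (u : A.Seed)
    {z z' : Query d M → ℝ} (T : ℕ)
    (h : ∀ t < T, z' (A.next t u (A.answers u z t)) = z (A.next t u (A.answers u z t))) :
    A.answers u z' T = A.answers u z T := by
  induction T with
  | zero => rfl
  | succ T ih =>
    have h1 := ih fun t ht => h t (ht.trans (Nat.lt_succ_self T))
    simp only [SQAlgorithm.answers, h1, h T (Nat.lt_succ_self T)]

lemma oracleRisk_le_one {d : ℕ} {M : ℝ} (G₀ G₁ : Set (Param d)) (A : SQAlgorithm d M)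
    (r : SQOracle d M) : oracleRisk G₀ G₁ A r ≤ 1 := by
  -- The test that never rejects.
  refine (iInf₂_le ∅ MeasurableSet.empty).trans ?_
  have h0 : ⨆ θ ∈ G₀, r.transcriptProb A θ ∅ = 0 := by
    simp [SQOracle.transcriptProb]
  rw [h0, zero_add]
  exact iSup₂_le fun θ _ => prob_le_one

/-- If every query is answered differently from the null for a small proportion of the
alternatives only, no test based on the answers is powerful. -/
lemma one_sub_le_oracleRisk {d s D : ℕ} {M : ℝ} (A : SQAlgorithm d M) {η ξ α γ p ε : ℝ} {n : ℕ}
    (h : s * D ≤ d) (hs : 1 ≤ s) (hD : 1 ≤ D) (hγ : 0 ≤ γ) (hp : 0 ≤ p)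
    (hdet : 0 < ξ → ξ < 1 / 2 → ∀ q : Query d M,
      ((detected h (Real.sqrt (γ / (4 * s))) η ξ α n q).card : ℝ) ≤ p * (D : ℝ) ^ s)
    (hε : ∀ F : Finset (Query d M), (F : Set (Query d M)) ⊆ A.queries → F.card ≤ A.rounds →
      F.card * p ≤ ε) :
    ENNReal.ofReal (1 - ε) ≤
      oracleRisk (nullSpace 1 α) (altSpace 1 α s γ) A (nullOracle η ξ α n 1) := by
  classical
  refine le_iInf₂ fun R hR => ?_
  set c := Real.sqrt (γ / (4 * s)) with hc
  set r : SQOracle d M := nullOracle η ξ α n 1 with hr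
  set θ : (Fin s → Fin D) → Param d := fun f => symmParam 1 α (blockVector h c f) with hθ
  set θ₀ : Param d := symmParam 1 α 0 with hθ₀
  set N : ℝ := (D : ℝ) ^ s with hN
  have hNpos : 0 < N := by
    have : (0 : ℝ) < D := by exact_mod_cast hD
    positivity
  have hcardN : (Fintype.card (Fin s → Fin D) : ℝ) = N := by simp [hN]
  have hεnn : 0 ≤ ε := by simpa using hε ∅ (by simp) (by simp)
  have hθ₀mem : θ₀ ∈ nullSpace 1 α :=
    ⟨⟨rfl, rfl⟩, by rw [hθ₀, symmParam_zero_mean, symmParam_zero_mean]⟩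
  have hθmem : ∀ f, θ f ∈ altSpace 1 α s γ := fun f =>
    symmParam_blockVector_mem_altSpace h hs α hγ f
  set det : Query d M → Finset (Fin s → Fin D) := fun q =>
    if 0 < ξ ∧ ξ < 1 / 2 then detected h c η ξ α n q else ∅ with hdetdef
  have hdetcard : ∀ q, ((det q).card : ℝ) ≤ p * N := by
    intro q
    by_cases hx : 0 < ξ ∧ ξ < 1 / 2
    · simp only [hdetdef, if_pos hx]
      exact hdet hx.1 hx.2 q
    · simp only [hdetdef, if_neg hx, Finset.card_empty, Nat.cast_zero]
      positivity
  have hans : ∀ q f, f ∉ det q → r.answer (θ f) q () = r.answer θ₀ q () := by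
    intro q f hf
    refine Eq.trans (if_neg ?_) (nullOracle_answer_null η ξ α n 1 q ()).symm
    rintro ⟨h1, h2, h3⟩
    apply hf
    simp only [hdetdef, if_pos (And.intro h1 h2)]
    exact mem_detected.2 h3
  set T : Param d → A.Seed → A.Seed × (Fin A.rounds → ℝ) := fun θ' u =>
    (u, A.answers u (fun q => r.answer θ' q ()) A.rounds) with hT
  have hTm : ∀ θ', Measurable (T θ') := fun θ' =>
    measurable_id.prodMk (measurable_answers_nullOracle A η ξ α n 1 θ' () A.rounds)
  have hprob : ∀ θ' {R' : Set (A.Seed × (Fin A.rounds → ℝ))}, MeasurableSet R' →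
      r.transcriptProb A θ' R' = A.seedLaw (T θ' ⁻¹' R') := fun θ' R' hR' =>
    transcriptProb_nullOracle A η ξ α n 1 θ' hR'
  -- Averaging over the alternatives is done for each seed separately: if the null transcript is
  -- accepted, so are the transcripts of at least `N (1 - ε)` alternatives.
  have hpt : ∀ u, ENNReal.ofReal (N * (1 - ε)) * (T θ₀ ⁻¹' Rᶜ).indicator 1 u ≤
      ∑ f, (T (θ f) ⁻¹' Rᶜ).indicator (1 : A.Seed → ℝ≥0∞) u := by
    intro u
    by_cases hu : u ∈ T θ₀ ⁻¹' Rᶜ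
    swap
    · rw [Set.indicator_of_notMem hu, mul_zero]
      exact zero_le
    set ask : ℕ → Query d M := fun t =>
      A.next t u (A.answers u (fun q => r.answer θ₀ q ()) t) with hask
    -- Only queries of the null run matter, since the first differing answer would have to occur on
    -- it. Repeated queries count once, which lets the capacity bound the cardinality.
    set F : Finset (Query d M) := (Finset.range A.rounds).image ask with hF
    set B : Finset (Fin s → Fin D) := F.biUnion det with hB
    have hFA : (F : Set (Query d M)) ⊆ A.queries := by
      intro q hq
      obtain ⟨t, _, rfl⟩ := Finset.mem_image.1 (Finset.mem_coe.1 hq)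
      exact A.next_mem t u _
    have hFc : F.card ≤ A.rounds := Finset.card_image_le.trans (by simp)
    have hBc : (B.card : ℝ) ≤ N * ε := by
      calc (B.card : ℝ) ≤ ∑ q ∈ F, ((det q).card : ℝ) := by exact_mod_cast Finset.card_biUnion_le
        _ ≤ ∑ q ∈ F, p * N := Finset.sum_le_sum fun q _ => hdetcard q
        _ = (F.card * p) * N := by rw [Finset.sum_const, nsmul_eq_mul]; ring
        _ ≤ ε * N := by gcongr; exact hε F hFA hFc
        _ = N * ε := mul_comm _ _
    have hsame : ∀ f ∈ Bᶜ, T (θ f) u = T θ₀ u := by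
      intro f hf
      simp only [hT, Prod.mk.injEq, true_and]
      refine A.answers_congr u A.rounds fun t ht => hans _ f fun hd => ?_
      exact Finset.mem_compl.1 hf (Finset.mem_biUnion.2
        ⟨ask t, Finset.mem_image.2 ⟨t, Finset.mem_range.2 ht, rfl⟩, hd⟩)
    calc ENNReal.ofReal (N * (1 - ε)) * (T θ₀ ⁻¹' Rᶜ).indicator 1 u
        = ENNReal.ofReal (N * (1 - ε)) := by
          rw [Set.indicator_of_mem hu, Pi.one_apply, mul_one]
      _ ≤ ENNReal.ofReal (Bᶜ.card : ℝ) := by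
          refine ENNReal.ofReal_le_ofReal ?_
          rw [Finset.card_compl, Nat.cast_sub (Finset.card_le_univ B), hcardN]
          linarith
      _ = ∑ f ∈ Bᶜ, (T (θ f) ⁻¹' Rᶜ).indicator (1 : A.Seed → ℝ≥0∞) u := by
          rw [ENNReal.ofReal_natCast, Finset.sum_congr rfl (g := fun _ => 1)]
          · simp
          · intro f hf
            have : u ∈ T (θ f) ⁻¹' Rᶜ := by
              rw [Set.mem_preimage, hsame f hf]
              exact hu
            rw [Set.indicator_of_mem this, Pi.one_apply]
      _ ≤ _ := Finset.sum_le_sum_of_subset (Finset.subset_univ _)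
  have hRc : ∀ θ', MeasurableSet (T θ' ⁻¹' Rᶜ) := fun θ' => hTm θ' hR.compl
  set sup₁ := ⨆ θ' ∈ altSpace 1 α s γ, r.transcriptProb A θ' Rᶜ with hsup
  have havg : ENNReal.ofReal (N * (1 - ε)) * A.seedLaw (T θ₀ ⁻¹' Rᶜ) ≤
      ENNReal.ofReal N * sup₁ := by
    calc ENNReal.ofReal (N * (1 - ε)) * A.seedLaw (T θ₀ ⁻¹' Rᶜ)
        = ∫⁻ u, ENNReal.ofReal (N * (1 - ε)) * (T θ₀ ⁻¹' Rᶜ).indicator 1 u ∂A.seedLaw := by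
          rw [lintegral_const_mul _ (measurable_one.indicator (hRc _)),
            lintegral_indicator_one (hRc _)]
      _ ≤ ∫⁻ u, ∑ f, (T (θ f) ⁻¹' Rᶜ).indicator (1 : A.Seed → ℝ≥0∞) u ∂A.seedLaw :=
          lintegral_mono hpt
      _ = ∑ f, A.seedLaw (T (θ f) ⁻¹' Rᶜ) := by
          rw [lintegral_finsetSum _ fun f _ => measurable_one.indicator (hRc _)]
          exact Finset.sum_congr rfl fun f _ => lintegral_indicator_one (hRc _)
      _ ≤ ∑ _f : Fin s → Fin D, sup₁ := by
          refine Finset.sum_le_sum fun f _ => ?_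
          rw [← hprob (θ f) hR.compl]
          exact le_iSup₂ (f := fun θ' _ => r.transcriptProb A θ' Rᶜ) (θ f) (hθmem f)
      _ = ENNReal.ofReal N * sup₁ := by
          rw [Finset.sum_const, nsmul_eq_mul, Finset.card_univ, ← hcardN, ENNReal.ofReal_natCast]
  have hsup₁ : ENNReal.ofReal (1 - ε) * A.seedLaw (T θ₀ ⁻¹' Rᶜ) ≤ sup₁ := by
    rw [ENNReal.ofReal_mul hNpos.le, mul_assoc] at havg
    exact (ENNReal.mul_le_mul_iff_right (by simpa using hNpos) ENNReal.ofReal_ne_top).1 havg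
  have h1 : A.seedLaw (T θ₀ ⁻¹' R) + A.seedLaw (T θ₀ ⁻¹' Rᶜ) = 1 := by
    rw [Set.preimage_compl, prob_add_prob_compl (hTm θ₀ hR)]
  calc ENNReal.ofReal (1 - ε)
      = ENNReal.ofReal (1 - ε) * A.seedLaw (T θ₀ ⁻¹' R) +
        ENNReal.ofReal (1 - ε) * A.seedLaw (T θ₀ ⁻¹' Rᶜ) := by rw [← mul_add, h1, mul_one]
    _ ≤ 1 * A.seedLaw (T θ₀ ⁻¹' R) + sup₁ := by
        gcongr
        rw [← ENNReal.ofReal_one]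
        exact ENNReal.ofReal_le_ofReal (by linarith)
    _ ≤ _ := by
        rw [one_mul, ← hprob θ₀ hR]
        gcongr
        exact le_iSup₂ (f := fun θ' _ => r.transcriptProb A θ' R) θ₀ hθ₀mem

/-! ### The risk at a fixed sample size -/

/-- Test the empty set of queries, with the convention `Real.log 0 = 0`. -/
lemma SQAlgorithm.IsCapacity.nonneg {d : ℕ} {M η : ℝ} {A : SQAlgorithm d M}
    (h : A.IsCapacity η) : 0 ≤ η := by
  simpa using h ∅ (by simp) (by simp)

lemma one_le_of_one_le_log {d : ℕ} (hd : 1 ≤ Real.log d) : (1 : ℝ) ≤ d := by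
  rcases Nat.eq_zero_or_pos d with rfl | h0
  · rw [Nat.cast_zero, Real.log_zero] at hd
    linarith
  · exact_mod_cast h0

/-- The constant of the separation rate below which a budget of `d ^ η` queries is useless. -/
def rateConstant (δ η : ℝ) : ℝ :=
  min (min 1 (δ / 8)) (δ / 10 / (Real.exp (3 * ⌈(η + 1) / δ⌉₊) + 3))

lemma rateConstant_pos {δ : ℝ} (hδ : 0 < δ) (η : ℝ) : 0 < rateConstant δ η := by
  unfold rateConstant
  positivity

/-- The squared tolerance is of order `log d / n`, so small overlaps are affordable at the price of
a constant `exp (3 k₀)`. The threshold `k₀` is chosen so that `(d ^ δ) ^ k₀ ≥ d ^ (η + 1)`, which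
handles the remaining overlaps. -/
lemma card_detected_le_of_large_capacity {d s D n : ℕ} {M α γ cap ξ δ η : ℝ} (h : s * D ≤ d)
    (hD : 1 ≤ D) (hn : 1 ≤ n) (hM : 0 < M) (hα : α ∈ Set.Icc (0 : ℝ) 1)
    (hγ : 0 ≤ γ) (hδ : 0 < δ) (hd : 1 ≤ Real.log d)
    (hsD : s * ((d : ℝ) ^ δ) ^ 2 ≤ D)
    (hH : (γ / (4 * s)) ^ 2 + α ^ 2 * (γ / (4 * s)) ≤ rateConstant δ η * (Real.log d / n))
    (hlog : Real.sqrt (Real.log d) + 2 ≤ δ * Real.log d)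
    (hcap : δ / 4 * Real.log d ≤ cap) (hξ0 : 0 < ξ) (hξ : ξ < 1 / 2) (q : Query d M) :
    ((detected h (Real.sqrt (γ / (4 * s))) cap ξ α n q).card : ℝ) ≤
      (d : ℝ) ^ (-(η + 1)) * (D : ℝ) ^ s := by
  set ℓ := Real.log d with hℓ
  set b := γ / (4 * s) with hb
  set k₀ := ⌈(η + 1) / δ⌉₊ with hk₀
  set ε := rateConstant δ η with hεdef
  have hε0 : 0 < ε := rateConstant_pos hδ η
  -- The three terms of the minimum serve, in turn, to give `b ≤ √(log d)`, to give `b ≤ 1`, and to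
  -- beat the tolerance at the end.
  have hε1 : ε ≤ 1 := (min_le_left _ _).trans (min_le_left _ _)
  have hε2 : ε ≤ δ / 8 := (min_le_left _ _).trans (min_le_right _ _)
  have hε3 : ε * (Real.exp (3 * k₀) + 3) ≤ δ / 10 := by
    have : ε ≤ δ / 10 / (Real.exp (3 * k₀) + 3) := min_le_right _ _
    rwa [le_div_iff₀ (by positivity)] at this
  have hn1 : (1 : ℝ) ≤ n := by exact_mod_cast hn
  have hn0 : (0 : ℝ) < n := by linarith
  have hb0 : 0 ≤ b := by positivity
  have hd1 : (1 : ℝ) ≤ d := one_le_of_one_le_log hd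
  have hd0 : (0 : ℝ) < d := by linarith
  have hlog2 : Real.log 2 ≤ Real.log (1 / ξ) := by
    refine Real.log_le_log two_pos ?_
    rw [le_div_iff₀ hξ0]
    linarith
  have hlog2' := Real.log_pos one_lt_two
  have hb2 : b ^ 2 ≤ ε * (ℓ / n) := by
    have : 0 ≤ α ^ 2 * b := by positivity
    linarith
  have hbl : b ≤ Real.sqrt ℓ := by
    refine Real.le_sqrt_of_sq_le (hb2.trans ?_)
    calc ε * (ℓ / n) ≤ 1 * ℓ := by gcongr; exact div_le_self (by linarith) hn1
      _ = ℓ := one_mul _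
  have hc2 : Real.sqrt b ^ 2 = b := Real.sq_sqrt hb0
  have hby : Real.exp (b + 2) ≤ (d : ℝ) ^ δ := by
    rw [Real.rpow_def_of_pos hd0, Real.exp_le_exp]
    linarith
  have hy1 : 1 ≤ (d : ℝ) ^ δ := Real.one_le_rpow hd1 hδ.le
  have hppos : 0 < (d : ℝ) ^ (-(η + 1)) := Real.rpow_pos_of_pos hd0 _
  by_contra hcon
  obtain ⟨h1, h2⟩ := lt_of_le_card_detected (G := Real.exp ((b + 2) * k₀)) (k₀ := k₀) h hD hn hM hα
    (by linarith [mul_nonneg (by positivity : 0 ≤ δ / 4) (by linarith : 0 ≤ ℓ)]) hy1 hsD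
    (by rwa [hc2]) (Real.exp_pos _).le
    (fun k _ hk => by rw [hc2]; gcongr) hppos q (not_le.1 hcon).le
  rw [hc2] at h1
  -- No relation between `log d` and `n` is assumed. If a query detects anything, its deviation of
  -- at most `2M` exceeds `L M / n`, so `L < 2n` and the lower bound on the capacity gives `log d /
  -- n ≤ 8 / δ`.
  have hb1 : b ≤ 1 := by
    have h3 : ℓ / n ≤ 8 / δ := by
      rw [div_le_div_iff₀ hn0 hδ]
      nlinarith
    have h4 : b ^ 2 ≤ 1 := by
      calc b ^ 2 ≤ ε * (ℓ / n) := hb2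
        _ ≤ δ / 8 * (8 / δ) := by gcongr
        _ = 1 := by field_simp
    nlinarith
  have hyk : 3 / (d : ℝ) ^ (-(η + 1)) / ((d : ℝ) ^ δ) ^ k₀ ≤ 3 := by
    rw [div_div, div_le_iff₀ (by positivity)]
    have : 1 ≤ (d : ℝ) ^ (-(η + 1)) * ((d : ℝ) ^ δ) ^ k₀ := by
      rw [← Real.rpow_natCast, ← Real.rpow_mul hd0.le, ← Real.rpow_add hd0]
      refine Real.one_le_rpow hd1 ?_
      have := Nat.le_ceil ((η + 1) / δ)
      rw [div_le_iff₀ hδ] at this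
      linarith
    linarith
  have hGe : Real.exp ((b + 2) * k₀) ≤ Real.exp (3 * k₀) := by
    gcongr
    linarith
  have hfin : (b ^ 2 + α ^ 2 * b) *
      (Real.exp ((b + 2) * k₀) + 3 / (d : ℝ) ^ (-(η + 1)) / ((d : ℝ) ^ δ) ^ k₀) ≤
      2 / 5 * (cap + Real.log (1 / ξ)) / n := by
    calc _ ≤ ε * (ℓ / n) * (Real.exp (3 * k₀) + 3) := by gcongr
      _ = ε * (Real.exp (3 * k₀) + 3) * (ℓ / n) := by ring
      _ ≤ δ / 10 * (ℓ / n) := by gcongr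
      _ = 2 / 5 * (δ / 4 * ℓ) / n := by ring
      _ ≤ _ := by gcongr; linarith
  linarith

/-- Now only `L ≥ log 2` is available, from `ξ < 1/2`. With `G = 0` and `k₀ = 1` the average
covariance gains the factor `d ^ (-δ/2)`, which beats the `log d` in the rate. -/
lemma card_detected_le_of_nonneg_capacity {d s D n : ℕ} {M α γ cap ξ δ η : ℝ} (h : s * D ≤ d)
    (hD : 1 ≤ D) (hn : 1 ≤ n) (hM : 0 < M) (hα : α ∈ Set.Icc (0 : ℝ) 1)
    (hγ : 0 ≤ γ) (hδ : 0 < δ) (hd : 1 ≤ Real.log d)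
    (hsD : s * ((d : ℝ) ^ δ) ^ 2 ≤ D)
    (hH : (γ / (4 * s)) ^ 2 + α ^ 2 * (γ / (4 * s)) ≤ rateConstant δ η * (Real.log d / n))
    (hlog : Real.sqrt (Real.log d) + 2 ≤ δ * Real.log d)
    (hlog2 : 3 * (Real.log d * (d : ℝ) ^ (-(δ / 2))) ≤ 2 / 5 * Real.log 2)
    (hcap : 0 ≤ cap) (hξ0 : 0 < ξ) (hξ : ξ < 1 / 2) (q : Query d M) :
    ((detected h (Real.sqrt (γ / (4 * s))) cap ξ α n q).card : ℝ) ≤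
      (d : ℝ) ^ (-(δ / 2)) * (D : ℝ) ^ s := by
  set ℓ := Real.log d with hℓ
  set b := γ / (4 * s) with hb
  set ε := rateConstant δ η with hεdef
  have hε0 : 0 < ε := rateConstant_pos hδ η
  have hε1 : ε ≤ 1 := (min_le_left _ _).trans (min_le_left _ _)
  have hn1 : (1 : ℝ) ≤ n := by exact_mod_cast hn
  have hn0 : (0 : ℝ) < n := by linarith
  have hb0 : 0 ≤ b := by positivity
  have hd1 : (1 : ℝ) ≤ d := one_le_of_one_le_log hd
  have hd0 : (0 : ℝ) < d := by linarith
  have hlogξ : Real.log 2 ≤ Real.log (1 / ξ) := by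
    refine Real.log_le_log two_pos ?_
    rw [le_div_iff₀ hξ0]
    linarith
  have hlog2' := Real.log_pos one_lt_two
  have hb2 : b ^ 2 ≤ ε * (ℓ / n) := by
    have : 0 ≤ α ^ 2 * b := by positivity
    linarith
  have hbl : b ≤ Real.sqrt ℓ := by
    refine Real.le_sqrt_of_sq_le (hb2.trans ?_)
    calc ε * (ℓ / n) ≤ 1 * ℓ := by gcongr; exact div_le_self (by linarith) hn1
      _ = ℓ := one_mul _
  have hc2 : Real.sqrt b ^ 2 = b := Real.sq_sqrt hb0
  have hby : Real.exp (b + 2) ≤ (d : ℝ) ^ δ := by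
    rw [Real.rpow_def_of_pos hd0, Real.exp_le_exp]
    linarith
  have hppos : 0 < (d : ℝ) ^ (-(δ / 2)) := Real.rpow_pos_of_pos hd0 _
  by_contra hcon
  obtain ⟨h1, -⟩ := lt_of_le_card_detected (G := 0) (k₀ := 1) h hD hn hM hα
    (by linarith) (Real.one_le_rpow hd1 hδ.le) hsD
    (by rwa [hc2]) le_rfl (fun k hk1 hk => by omega) hppos q (not_le.1 hcon).le
  rw [hc2, zero_add, pow_one] at h1
  have hy : 3 / (d : ℝ) ^ (-(δ / 2)) / (d : ℝ) ^ δ = 3 * (d : ℝ) ^ (-(δ / 2)) := by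
    rw [div_div, ← Real.rpow_add hd0, div_eq_mul_inv, ← Real.rpow_neg hd0.le]
    congr 2
    ring
  have hfin : (b ^ 2 + α ^ 2 * b) * (3 / (d : ℝ) ^ (-(δ / 2)) / (d : ℝ) ^ δ) ≤
      2 / 5 * (cap + Real.log (1 / ξ)) / n := by
    rw [hy]
    calc _ ≤ 1 * (ℓ / n) * (3 * (d : ℝ) ^ (-(δ / 2))) := by
          gcongr
          exact hH.trans (by gcongr)
      _ = 3 * (ℓ * (d : ℝ) ^ (-(δ / 2))) / n := by ring
      _ ≤ 2 / 5 * (cap + Real.log (1 / ξ)) / n := by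
          refine div_le_div_of_nonneg_right (hlog2.trans ?_) hn0.le
          linarith
  linarith

lemma le_oracleRisk_of_rate {d s D n : ℕ} {M α γ cap ξ δ η : ℝ} (A : SQAlgorithm d M)
    (hcap : A.IsCapacity cap) (hA : (A.rounds : ℝ) ≤ (d : ℝ) ^ η)
    (h : s * D ≤ d) (hs : 1 ≤ s)
    (hD : 1 ≤ D) (hn : 1 ≤ n) (hM : 0 < M) (hα : α ∈ Set.Icc (0 : ℝ) 1)
    (hγ : 0 ≤ γ) (hδ : 0 < δ) (hd : 1 ≤ Real.log d)
    (hsD : s * ((d : ℝ) ^ δ) ^ 2 ≤ D)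
    (hH : (γ / (4 * s)) ^ 2 + α ^ 2 * (γ / (4 * s)) ≤ rateConstant δ η * (Real.log d / n))
    (hlog : Real.sqrt (Real.log d) + 2 ≤ δ * Real.log d)
    (hlog2 : 3 * (Real.log d * (d : ℝ) ^ (-(δ / 2))) ≤ 2 / 5 * Real.log 2) :
    ENNReal.ofReal (1 - ((d : ℝ) ^ (-1 : ℝ) + (d : ℝ) ^ (-(δ / 4)))) ≤
      oracleRisk (nullSpace 1 α) (altSpace 1 α s γ) A (nullOracle cap ξ α n 1) := by
  have hd0 : (0 : ℝ) < d := zero_lt_one.trans_le (one_le_of_one_le_log hd)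
  have hpos : ∀ t : ℝ, 0 < (d : ℝ) ^ t := fun t => Real.rpow_pos_of_pos hd0 t
  rcases le_or_gt (δ / 4 * Real.log d) cap with hc | hc
  · refine one_sub_le_oracleRisk A h hs hD hγ (hpos (-(η + 1))).le
      (fun hξ0 hξ q => card_detected_le_of_large_capacity h hD hn hM hα hγ hδ hd hsD hH hlog hc
        hξ0 hξ q) fun F _ hF => ?_
    calc (F.card : ℝ) * (d : ℝ) ^ (-(η + 1)) ≤ (d : ℝ) ^ η * (d : ℝ) ^ (-(η + 1)) := by
          gcongr
          exact le_trans (by exact_mod_cast hF) hA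
      _ = (d : ℝ) ^ (-1 : ℝ) := by rw [← Real.rpow_add hd0]; congr 1; ring
      _ ≤ _ := le_add_of_nonneg_right (hpos _).le
  · refine one_sub_le_oracleRisk A h hs hD hγ (hpos (-(δ / 2))).le
      (fun hξ0 hξ q => card_detected_le_of_nonneg_capacity h hD hn hM hα hγ hδ hd hsD hH hlog hlog2
        hcap.nonneg hξ0 hξ q) fun F hFA hF => ?_
    have hFc : (F.card : ℝ) ≤ (d : ℝ) ^ (δ / 4) := by
      rcases Nat.eq_zero_or_pos F.card with h0 | h0
      · rw [h0, Nat.cast_zero]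
        exact (hpos _).le
      · rw [← Real.log_le_log_iff (by exact_mod_cast h0) (hpos _), Real.log_rpow hd0]
        exact (hcap F hFA hF).trans hc.le
    calc (F.card : ℝ) * (d : ℝ) ^ (-(δ / 2)) ≤ (d : ℝ) ^ (δ / 4) * (d : ℝ) ^ (-(δ / 2)) := by
          gcongr
      _ = (d : ℝ) ^ (-(δ / 4)) := by rw [← Real.rpow_add hd0]; congr 1; ring
      _ ≤ _ := le_add_of_nonneg_left (hpos _).le

/-! ### Asymptotics -/

/-- Since `s ≥ 1`, the sparsity condition forces `d ^ a → ∞`. A nonpositive exponent is thereby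
excluded, because `d ^ a ≤ 1` then, also for `d = 0` by the conventions for powers of zero. -/
lemma tendsto_dimension_atTop {d s : ℕ → ℕ} {a : ℝ} (hs : ∀ n, 1 ≤ s n)
    (hsd : (fun n => (s n : ℝ)) =o[atTop] fun n => (d n : ℝ) ^ a) :
    Tendsto d atTop atTop := by
  have h1 : (fun _ : ℕ => (1 : ℝ)) =o[atTop] fun n => (d n : ℝ) ^ a := by
    refine Asymptotics.IsBigO.trans_isLittleO ?_ hsd
    refine Asymptotics.isBigO_of_le _ fun n => ?_
    have : (1 : ℝ) ≤ s n := by exact_mod_cast hs n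
    simpa using this
  have h2 : Tendsto (fun n => (d n : ℝ) ^ a) atTop atTop := by
    have := (Asymptotics.isLittleO_one_left_iff ℝ).1 h1
    refine this.congr fun n => ?_
    rw [Real.norm_of_nonneg (by positivity)]
  refine tendsto_atTop.2 fun K => ?_
  filter_upwards [h2.eventually_gt_atTop (max 1 ((K : ℝ) ^ a))] with n hn
  have hn1 := (le_max_left _ _).trans_lt hn
  have hn2 := (le_max_right _ _).trans_lt hn
  by_contra hc
  push Not at hc
  rcases le_or_gt a 0 with ha | ha
  · rcases Nat.eq_zero_or_pos (d n) with h0 | h0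
    · rw [h0] at hn1
      rcases ha.lt_or_eq with ha | ha
      · rw [Nat.cast_zero, Real.zero_rpow ha.ne] at hn1
        linarith
      · rw [ha, Real.rpow_zero] at hn1
        linarith
    · have := Real.rpow_le_one_of_one_le_of_nonpos (x := (d n : ℝ)) (by exact_mod_cast h0) ha
      linarith
  · have : (d n : ℝ) ^ a ≤ (K : ℝ) ^ a := by
      gcongr
    linarith

lemma minSupervised_le (α a b : ℝ) : minSupervised α a b ≤ a := by
  unfold minSupervised
  split_ifs
  · exact le_rfl
  · exact min_le_left _ _

lemma sq_mul_minSupervised_le (α a : ℝ) {b : ℝ} (hb : 0 ≤ b) :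
    α ^ 2 * minSupervised α a b ≤ b := by
  unfold minSupervised
  split_ifs with h
  · simp [h, hb]
  · calc α ^ 2 * min a (1 / α ^ 2 * b) ≤ α ^ 2 * (1 / α ^ 2 * b) := by
          gcongr
          exact min_le_right _ _
      _ = b := by field_simp

lemma max_rate_le {n d s : ℕ} {α : ℝ} (hs : 1 ≤ s) (hd : 1 ≤ Real.log d) :
    max (infoRate n d s α) (queryRate n s α) ≤ s * Real.sqrt (Real.log d / n) := by
  have hs1 : (1 : ℝ) ≤ s := by exact_mod_cast hs
  have hss : (s : ℝ) ≤ (s : ℝ) ^ 2 := by nlinarith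
  have hr : (s : ℝ) * Real.sqrt (Real.log d / n) =
      Real.sqrt ((s : ℝ) ^ 2 * Real.log d / n) := by
    rw [mul_div_assoc, Real.sqrt_mul (by positivity), Real.sqrt_sq (by positivity)]
  rw [hr]
  refine max_le ((minSupervised_le _ _ _).trans ?_) ((minSupervised_le _ _ _).trans ?_)
  · gcongr
  · gcongr
    nlinarith

lemma sq_mul_max_rate_le {n d s : ℕ} {α : ℝ} (hd : 1 ≤ Real.log d) :
    α ^ 2 * max (infoRate n d s α) (queryRate n s α) ≤ s * (Real.log d / n) := by
  rw [mul_max_of_nonneg _ _ (sq_nonneg α)]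
  refine max_le ((sq_mul_minSupervised_le _ _ (by positivity)).trans ?_)
    ((sq_mul_minSupervised_le _ _ (by positivity)).trans ?_)
  · rw [mul_div_assoc]
  · rw [← mul_div_assoc]
    gcongr
    nlinarith [(Nat.cast_nonneg s : (0 : ℝ) ≤ s)]

/-- The two branches of the minimum in each rate control the two terms of the covariance factor: the
square-root branch bounds `b²`, the supervised branch bounds `α² b`. -/
lemma sq_add_le_of_le_mul_max_rate {n d s : ℕ} {α γ κ : ℝ} (hs : 1 ≤ s) (hd : 1 ≤ Real.log d)
    (hγ : 0 ≤ γ) (hκ0 : 0 ≤ κ) (hκ1 : κ ≤ 1)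
    (hle : γ ≤ κ * max (infoRate n d s α) (queryRate n s α)) :
    (γ / (4 * s)) ^ 2 + α ^ 2 * (γ / (4 * s)) ≤ 2 * κ * (Real.log d / n) := by
  have hs0 : (0 : ℝ) < s := by exact_mod_cast hs
  have h1 : γ / (4 * s) ≤ γ / s := by
    gcongr
    linarith
  have hb : γ / s ≤ κ * Real.sqrt (Real.log d / n) := by
    rw [div_le_iff₀ hs0]
    calc γ ≤ κ * max (infoRate n d s α) (queryRate n s α) := hle
      _ ≤ κ * (s * Real.sqrt (Real.log d / n)) := by gcongr; exact max_rate_le hs hd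
      _ = _ := by ring
  have hb2 : α ^ 2 * (γ / s) ≤ κ * (Real.log d / n) := by
    rw [← mul_div_assoc, div_le_iff₀ hs0]
    calc α ^ 2 * γ ≤ α ^ 2 * (κ * max (infoRate n d s α) (queryRate n s α)) := by gcongr
      _ = κ * (α ^ 2 * max (infoRate n d s α) (queryRate n s α)) := by ring
      _ ≤ κ * (s * (Real.log d / n)) :=
          mul_le_mul_of_nonneg_left (sq_mul_max_rate_le hd) hκ0
      _ = _ := by ring
  have h2 : (γ / (4 * s)) ^ 2 ≤ κ * (Real.log d / n) := by
    calc (γ / (4 * s)) ^ 2 ≤ (κ * Real.sqrt (Real.log d / n)) ^ 2 := by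
          gcongr
          exact h1.trans hb
      _ = κ * (κ * (Real.log d / n)) := by
          rw [mul_pow, Real.sq_sqrt (by positivity)]
          ring
      _ ≤ 1 * (κ * (Real.log d / n)) := by gcongr
      _ = _ := one_mul _
  have h3 : α ^ 2 * (γ / (4 * s)) ≤ α ^ 2 * (γ / s) := by gcongr
  linarith

lemma mul_sq_rpow_le_div {d s : ℕ} {δ : ℝ} (hs : 1 ≤ s) (hδ : 0 < δ) (hd : 1 ≤ d)
    (hsd : (s : ℝ) ≤ 1 / 2 * (d : ℝ) ^ (1 / 2 - δ)) :
    s * ((d : ℝ) ^ δ) ^ 2 ≤ (d / s : ℕ) ∧ 1 ≤ d / s := by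
  have hs1 : (1 : ℝ) ≤ s := by exact_mod_cast hs
  have hd1 : (1 : ℝ) ≤ d := by exact_mod_cast hd
  have hd0 : (0 : ℝ) < d := by linarith
  set y := (d : ℝ) ^ δ with hy
  have hy1 : 1 ≤ y := Real.one_le_rpow hd1 hδ.le
  have hz : (d : ℝ) ^ (1 / 2 - δ) * y = Real.sqrt d := by
    rw [hy, ← Real.rpow_add hd0, Real.sqrt_eq_rpow]
    congr 1
    ring
  have h1 : ((s : ℝ) * y) ^ 2 ≤ d / 4 := by
    have : s * y ≤ 1 / 2 * Real.sqrt d := by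
      rw [← hz]
      calc s * y ≤ 1 / 2 * (d : ℝ) ^ (1 / 2 - δ) * y := by gcongr
        _ = _ := by ring
    calc ((s : ℝ) * y) ^ 2 ≤ (1 / 2 * Real.sqrt d) ^ 2 := by gcongr
      _ = (d : ℝ) / 4 := by rw [mul_pow, Real.sq_sqrt hd0.le]; ring
  have h2 : (d : ℝ) < (((d / s : ℕ) : ℝ) + 1) * s := by
    have := Nat.lt_div_mul_add (a := d) (b := s) hs
    have h3 : (d : ℝ) < (d / s : ℕ) * s + s := by exact_mod_cast this
    linarith
  -- Rounding `d / s` down loses less than `s ≤ (s y)²`, while `d ≥ 4 (s y)²`; the factor `1/2` in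
  -- the sparsity bound provides this room.
  have h4 : s * y ^ 2 * s ≤ (d / s : ℕ) * s := by
    have : (s : ℝ) * 1 ≤ (s * y) ^ 2 := by
      rw [mul_pow, sq (s : ℝ)]
      nlinarith [one_le_pow₀ hy1 (n := 2)]
    nlinarith
  have h5 : s * y ^ 2 ≤ (d / s : ℕ) := le_of_mul_le_mul_right h4 (by linarith)
  refine ⟨h5, ?_⟩
  have : (0 : ℝ) < (d / s : ℕ) := lt_of_lt_of_le (by positivity) h5
  exact_mod_cast this

lemma tendsto_log_mul_rpow_neg {c : ℝ} (hc : 0 < c) :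
    Tendsto (fun x : ℝ => Real.log x * x ^ (-c)) atTop (𝓝 0) := by
  refine (isLittleO_log_rpow_atTop hc).tendsto_div_nhds_zero.congr' ?_
  filter_upwards [eventually_ge_atTop 0] with x hx
  rw [Real.rpow_neg hx, div_eq_mul_inv]

lemma eventually_sqrt_log_add_two_le {δ : ℝ} (hδ : 0 < δ) :
    ∀ᶠ x : ℝ in atTop, Real.sqrt (Real.log x) + 2 ≤ δ * Real.log x := by
  have h : ∀ᶠ t : ℝ in atTop, Real.sqrt t + 2 ≤ δ * t := by
    filter_upwards [eventually_ge_atTop (4 / δ), eventually_ge_atTop ((2 / δ) ^ 2)] with t h1 h2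
    rw [div_le_iff₀ hδ] at h1
    have h3 : 2 / δ ≤ Real.sqrt t := Real.le_sqrt_of_sq_le h2
    rw [div_le_iff₀ hδ] at h3
    have h4 : 0 ≤ t := (by positivity : (0 : ℝ) ≤ (2 / δ) ^ 2).trans h2
    nlinarith [Real.sq_sqrt h4, Real.sqrt_nonneg t]
  exact Real.tendsto_log_atTop.eventually h

end

theorem theorem3
    -- dimension, sparsity, supervision level, separation and tail probability at sample size `n`
    (d s : ℕ → ℕ) (α γ ξ : ℕ → ℝ) (δ : ℝ)
    (hs : ∀ n, 1 ≤ s n)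
    (hδ : 0 < δ)
    (hsd : (fun n => (s n : ℝ)) =o[atTop] fun n => (d n : ℝ) ^ (1 / 2 - δ))
    (hα : ∀ n, α n ∈ Set.Icc (0 : ℝ) 1)
    (hξ : ∀ n, ξ n ∈ Set.Ico (0 : ℝ) 1)
    (hγ0 : ∀ n, 0 ≤ γ n)
    (hγ : γ =o[atTop] fun n =>
      max (infoRate n (d n) (s n) (α n)) (queryRate n (s n) (α n)))
    -- a polynomial budget, and an algorithm for every sample size and every known covariance matrix
    (η : ℝ) (hη : 0 < η)
    (M : ℕ → ℝ) (hM : ∀ n, 0 < M n)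
    (A : (n : ℕ) → Matrix (Fin (d n)) (Fin (d n)) ℝ → SQAlgorithm (d n) (M n))
    (hA : ∀ n S, S.PosDef → ((A n S).rounds : ℝ) ≤ (d n : ℝ) ^ η)
    (cap : (n : ℕ) → Matrix (Fin (d n)) (Fin (d n)) ℝ → ℝ)
    (hcap : ∀ n S, S.PosDef → (A n S).IsCapacity (cap n S)) :
    ∃ r : (n : ℕ) → Matrix (Fin (d n)) (Fin (d n)) ℝ → SQOracle (d n) (M n),
      (∀ n S, S.PosDef → (r n S).Admissible (A n S) (cap n S) (ξ n) n S (α n)) ∧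
      Tendsto
        (fun n => ⨆ (S : Matrix (Fin (d n)) (Fin (d n)) ℝ) (_ : S.PosDef),
          oracleRisk (nullSpace S (α n)) (altSpace S (α n) (s n) (γ n)) (A n S) (r n S))
        atTop (𝓝 1) := by
  refine ⟨fun n S => nullOracle (cap n S) (ξ n) (α n) n S,
    fun n S _ => nullOracle_admissible (A n S) _ _ _ _ _, ?_⟩
  have hd : Tendsto d atTop atTop := tendsto_dimension_atTop hs hsd
  have hdr : Tendsto (fun n => (d n : ℝ)) atTop atTop := tendsto_natCast_atTop_atTop.comp hd
  have hlow : Tendsto (fun n => ENNReal.ofReal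
      (1 - ((d n : ℝ) ^ (-1 : ℝ) + (d n : ℝ) ^ (-(δ / 4))))) atTop (𝓝 1) := by
    have h1 := (tendsto_rpow_neg_atTop one_pos).comp hdr
    have h2 := (tendsto_rpow_neg_atTop (by positivity : 0 < δ / 4)).comp hdr
    have h3 := ENNReal.tendsto_ofReal ((h1.add h2).const_sub 1)
    simpa using h3
  refine tendsto_of_tendsto_of_tendsto_of_le_of_le' hlow tendsto_const_nhds ?_
    (Eventually.of_forall fun n => iSup₂_le fun S _ => oracleRisk_le_one _ _ _ _)
  -- The division by 2 pays for the two terms `b²` and `α² b`, each bounded by `κ log d / n`.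
  set κ := min 1 (rateConstant δ η / 2) with hκ
  have hκ0 : 0 < κ := by
    have := rateConstant_pos hδ η
    positivity
  have hlog2 : ∀ᶠ x : ℝ in atTop,
      3 * (Real.log x * x ^ (-(δ / 2))) ≤ 2 / 5 * Real.log 2 := by
    have h1 := (tendsto_log_mul_rpow_neg (by positivity : 0 < δ / 2)).const_mul 3
    rw [mul_zero] at h1
    have h2 : 0 < 2 / 5 * Real.log 2 := by
      have := Real.log_pos one_lt_two
      positivity
    exact (h1.eventually_lt_const h2).mono fun x hx => hx.le
  filter_upwards [eventually_ge_atTop 1, hd.eventually_ge_atTop 1,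
    hdr.eventually (Real.tendsto_log_atTop.eventually_ge_atTop 1),
    hdr.eventually (eventually_sqrt_log_add_two_le hδ), hdr.eventually hlog2,
    hsd.def (by norm_num : (0 : ℝ) < 1 / 2), hγ.def hκ0] with n hn hd1 hl hsq hl2 hsn hγn
  rw [Real.norm_of_nonneg (by positivity), Real.norm_of_nonneg (by positivity)] at hsn
  have hrate0 : 0 ≤ max (infoRate n (d n) (s n) (α n)) (queryRate n (s n) (α n)) := by
    refine le_max_of_le_right ?_
    unfold queryRate minSupervised
    split_ifs <;> positivity
  rw [Real.norm_of_nonneg (hγ0 n), Real.norm_of_nonneg hrate0] at hγn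
  obtain ⟨hsD, hD⟩ := mul_sq_rpow_le_div (hs n) hδ hd1 hsn
  have hH := sq_add_le_of_le_mul_max_rate (hs n) hl (hγ0 n) hκ0.le (min_le_left _ _) hγn
  have hH' := hH.trans (mul_le_mul_of_nonneg_right
    (by linarith [min_le_right 1 (rateConstant δ η / 2)] : 2 * κ ≤ rateConstant δ η)
    (by positivity))
  -- The block length is the floor of `d / s`, and the supremum over covariances is bounded below by
  -- its value at the identity.
  exact (le_oracleRisk_of_rate (A n 1) (hcap n 1 Matrix.PosDef.one) (hA n 1 Matrix.PosDef.one)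
    (Nat.mul_div_le _ _) (hs n) hD hn (hM n) (hα n) (hγ0 n) hδ hl hsD hH' hsq hl2).trans
    (le_iSup₂ (f := fun (S : Matrix (Fin (d n)) (Fin (d n)) ℝ) (_ : S.PosDef) => oracleRisk (nullSpace S (α n))
      (altSpace S (α n) (s n) (γ n)) (A n S) (nullOracle (cap n S) (ξ n) (α n) n S)) 1
      Matrix.PosDef.one)
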